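/- Let $\mathcal H$ be a complex Hilbert space (of any dimension), $\Theta\subset\mathbb R^m$ open, and let $\theta\mapsto|\phi(\theta)\rangle\in\mathcal H$ be a family of unit vectors on $\Theta$ that is differentiable at $\theta\in\Theta$; put $\rho=|\phi\rangle\langle\phi|$. Let $|l_i\rangle=2\bigl(\partial_i|\phi\rangle-\langle\phi|\partial_i\phi\rangle|\phi\rangle\bigr)$ be the horizontal lift of $\partial_i\rho$ at $\theta$, i.e. the vector with $\partial_i\rho=\tfrac12(|l_i\rangle\langle\phi|+|\phi\rangle\langle l_i|)$ and $\langle l_i|\phi\rangle=0$, and assume that $|l_1\rangle,\dots,|l_m\rangle$ are linearly independent over $\mathbb R$. Put $J^S=[\mathrm{Re}\langle l_i|l_j\rangle]$ and $\tilde J=[\mathrm{Im}\langle l_i|l_j\rangle]$. An estimator is a positive-operator-valued measure $M$ on the Borel sets of $\mathbb R^m$ with $M(\mathbb R^m)=I$. It is locally unbiased at $\theta$ if $\hat\theta$ has finite second moments under $\langle\phi|M(\cdot)|\phi\rangle$, $\int\hat\theta^j\langle\phi|M(d\hat\theta)|\phi\rangle=\theta^j$, and $\int\hat\theta^j\,\mathrm{tr}\bigl(\partial_i\rho(\theta)\,M(d\hat\theta)\bigr)=\delta_i^j$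 for all $i,j$, where $\mathrm{tr}(\partial_i\rho\,M(B))=\mathrm{Re}\langle l_i|M(B)|\phi\rangle$. Let $V_\theta[M]$ be its covariance matrix, and for a weight matrix $G$ let $$\mathrm{CR}(G)=\min\{\mathrm{Tr}\,G\,V_\theta[M] : M \text{ locally unbiased at }\theta\}.$$ Let $\mathbf D$ be the linear map of the tangent space $T=\mathrm{span}_{\mathbb R}\{|l_1\rangle,\dots,|l_m\rangle\}$, with metric $\mathrm{Re}\langle\cdot|\cdot\rangle$, that sends $x$ to the orthogonal projection of $ix$ onto $T$. Theorem. The minimum defining $\mathrm{CR}(J^S)$ exists, and $$\mathrm{CR}(J^S)=\mathrm{Tr}\Bigl\{\mathrm{Re}\bigl(I_m+i\,(J^S)^{-1/2}\tilde J\,(J^S)^{-1/2}\bigr)^{1/2}\Bigr\}^{-2}=\sum_{\alpha}\frac{2}{1+(1-|\alpha|^2)^{1/2}},$$ where $\alpha$ runs over the complex eigenvalues of $\mathbf D$, counted with algebraic multiplicity. The minimum exists and has the same value if one admits only those locally unbiased $M$ for which, in addition, $E_\eta[\hat\theta]=\int\hat\theta\,\langle\phi(\eta)|M(d\hat\theta)|\phi(\eta)\rangle$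 exists for all $\eta$ near $\theta$ and is differentiable in $\eta$ at $\theta$ with derivative the identity. -/

import Mathlib

noncomputable section

namespace PureStateEstimation

open MeasureTheory Matrix
open scoped ENNReal Topology InnerProductSpace

variable {H : Type*} [NormedAddCommGroup H] [InnerProductSpace ℂ H]

/-! ### Measurements -/

/-- A measurement on `H` with data space `Ω`: a (generalized, positive operator valued) measure `M`
on the measurable sets of `Ω`, countably additive in the strong operator topology, with
`M Ω = 1`. -/
structure Measurement (H : Type*) [NormedAddCommGroup H] [InnerProductSpace ℂ H]
    (Ω : Type*) [MeasurableSpace Ω] where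
  /-- the operator attached to an event -/
  op : Set Ω → H →L[ℂ] H
  isPositive : ∀ B, MeasurableSet B → (op B).IsPositive
  op_empty : op ∅ = 0
  op_univ : op Set.univ = 1
  hasSum_iUnion : ∀ B : ℕ → Set Ω, (∀ k, MeasurableSet (B k)) →
    Pairwise (Function.onFun Disjoint B) →
    ∀ v : H, HasSum (fun k => op (B k) v) (op (⋃ k, B k) v)

namespace Measurement

variable {Ω : Type*} [MeasurableSpace Ω]

/-- The signed measure `B ↦ Re ⟨u | M(B) | v⟩`. -/
def reInner (M : Measurement H Ω) (u v : H) : SignedMeasure Ω := by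
  classical
  exact
  { measureOf' := fun B => if MeasurableSet B then (⟪u, M.op B v⟫_ℂ).re else 0
    empty' := by simp [M.op_empty]
    not_measurable' := fun B hB => by simp [hB]
    m_iUnion' := fun B hB hd => by
      have h := M.hasSum_iUnion B hB hd v
      have h2 := (h.mapL (innerSL ℂ u)).mapL Complex.reCLM
      simpa [hB, MeasurableSet.iUnion hB] using h2 }

theorem reInner_apply (M : Measurement H Ω) (u v : H) {B : Set Ω} (hB : MeasurableSet B) :
    M.reInner u v B = (⟪u, M.op B v⟫_ℂ).re :=
  if_pos hB

theorem reInner_self_nonneg (M : Measurement H Ω) (ψ : H) :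
    VectorMeasure.restrict 0 Set.univ ≤ (M.reInner ψ ψ).restrict Set.univ := by
  rw [VectorMeasure.restrict_le_restrict_iff _ _ MeasurableSet.univ]
  intro B hB _
  rw [reInner_apply M ψ ψ hB]
  exact (M.isPositive B hB).re_inner_nonneg_right ψ

/-- The law of the data when the system is in the pure state `|ψ⟩⟨ψ|`:
`Pr(B) = tr (|ψ⟩⟨ψ| M(B)) = ⟨ψ | M(B) | ψ⟩`. -/
def prob (M : Measurement H Ω) (ψ : H) : Measure Ω :=
  (M.reInner ψ ψ).toMeasureOfZeroLE Set.univ MeasurableSet.univ (M.reInner_self_nonneg ψ)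

theorem prob_apply (M : Measurement H Ω) (ψ : H) {B : Set Ω} (hB : MeasurableSet B) :
    M.prob ψ B = ENNReal.ofReal (⟪ψ, M.op B ψ⟫_ℂ).re := by
  rw [prob, SignedMeasure.toMeasureOfZeroLE_apply _ _ _ hB, ENNReal.ofReal,
    ENNReal.coe_inj]
  apply NNReal.eq
  have h0 : 0 ≤ (⟪ψ, M.op B ψ⟫_ℂ).re := (M.isPositive B hB).re_inner_nonneg_right ψ
  simp [Real.coe_toNNReal _ h0, reInner_apply M ψ ψ hB]

end Measurement

/-! ### Pure state models

A model is given by unit vectors `φ θ`, where `θ` runs through an open subset of `ℝ^m`; its states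
are `ρ(θ) = |φ θ⟩⟨φ θ|`. -/

variable {m : ℕ}

/-- The partial derivative `∂_i |φ⟩` at `θ`. -/
def partialDeriv (φ : (Fin m → ℝ) → H) (θ : Fin m → ℝ) (i : Fin m) : H :=
  fderiv ℝ φ θ (Pi.single i 1)

/-- The horizontal lift `|l_i⟩` of `∂_i ρ` at `|φ θ⟩`, i.e. the unique vector with
`∂_i ρ = (|l_i⟩⟨φ| + |φ⟩⟨l_i|) / 2` and `⟨l_i | φ⟩ = 0`. -/
def horizontalLift (φ : (Fin m → ℝ) → H) (θ : Fin m → ℝ) (i : Fin m) : H :=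
  (2 : ℂ) • (partialDeriv φ θ i - ⟪φ θ, partialDeriv φ θ i⟫_ℂ • φ θ)

theorem re_inner_partialDeriv {φ : (Fin m → ℝ) → H} {θ : Fin m → ℝ}
    (hunit : ∀ᶠ η in 𝓝 θ, ‖φ η‖ = 1) (hφ : DifferentiableAt ℝ φ θ) (i : Fin m) :
    (⟪φ θ, partialDeriv φ θ i⟫_ℂ).re = 0 := by
  let : InnerProductSpace ℝ H := InnerProductSpace.complexToReal
  have h1 := (hφ.hasFDerivAt.norm_sq)
  have h2 : HasFDerivAt (fun η => ‖φ η‖ ^ 2) (0 : (Fin m → ℝ) →L[ℝ] ℝ) θ := by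
    refine (hasFDerivAt_const (1 : ℝ) θ).congr_of_eventuallyEq ?_
    filter_upwards [hunit] with η hη
    simp [hη]
  have h3 := congrArg (fun L => L (Pi.single i 1)) (h1.unique h2)
  have h4 : (2 : ℝ) * (⟪φ θ, partialDeriv φ θ i⟫_ℂ).re = 0 := by simpa using! h3
  linarith

theorem inner_horizontalLift {φ : (Fin m → ℝ) → H} {θ : Fin m → ℝ} (hunit : ‖φ θ‖ = 1)
    (i : Fin m) : ⟪horizontalLift φ θ i, φ θ⟫_ℂ = 0 := by
  simp [horizontalLift, inner_self_eq_norm_sq_to_K, hunit]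

/-- The defining equation of the lift, applied to a vector `v`. -/
theorem horizontalLift_spec {φ : (Fin m → ℝ) → H} {θ : Fin m → ℝ}
    (hunit : ∀ᶠ η in 𝓝 θ, ‖φ η‖ = 1) (hφ : DifferentiableAt ℝ φ θ) (i : Fin m) (v : H) :
    fderiv ℝ (fun η => ⟪φ η, v⟫_ℂ • φ η) θ (Pi.single i 1) =
      (2⁻¹ : ℂ) • (⟪φ θ, v⟫_ℂ • horizontalLift φ θ i + ⟪horizontalLift φ θ i, v⟫_ℂ • φ θ) := by
  have hl : HasFDerivAt (fun η => ⟪φ η, v⟫_ℂ • φ η) _ θ :=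
    (hφ.hasFDerivAt.inner ℂ (hasFDerivAt_const v θ)).smul hφ.hasFDerivAt
  rw [hl.fderiv]
  have hre := re_inner_partialDeriv hunit hφ i
  have hconj : (starRingEnd ℂ) ⟪φ θ, partialDeriv φ θ i⟫_ℂ = - ⟪φ θ, partialDeriv φ θ i⟫_ℂ := by
    apply Complex.ext
    · rw [Complex.conj_re, Complex.neg_re, hre, neg_zero]
    · rw [Complex.conj_im, Complex.neg_im]
  have key : ∀ (w : H) (a b c : ℂ), (starRingEnd ℂ) a = -a →
      b • w + c • φ θ = (2⁻¹ : ℂ) • (b • ((2 : ℂ) • (w - a • φ θ)) +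
        ((c - b * (starRingEnd ℂ) a) * 2) • φ θ) := by
    intro w a b c ha
    rw [ha]
    module
  simpa [horizontalLift, inner_smul_left, inner_sub_left, partialDeriv, fderivInnerCLM_apply]
    using key (partialDeriv φ θ i) ⟪φ θ, partialDeriv φ θ i⟫_ℂ ⟪φ θ, v⟫_ℂ
      ⟪partialDeriv φ θ i, v⟫_ℂ hconj

/-- The matrix `𝖫* 𝖫 = [⟨l_i | l_j⟩]`. -/
def gram (φ : (Fin m → ℝ) → H) (θ : Fin m → ℝ) : Matrix (Fin m) (Fin m) ℂ :=
  Matrix.of fun i j => ⟪horizontalLift φ θ i, horizontalLift φ θ j⟫_ℂ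

/-- The SLD Fisher information matrix `J^S = Re 𝖫* 𝖫`. -/
def fisher (φ : (Fin m → ℝ) → H) (θ : Fin m → ℝ) : Matrix (Fin m) (Fin m) ℝ :=
  (gram φ θ).map Complex.re

/-- The skew matrix `J̃ = Im 𝖫* 𝖫`. -/
def skew (φ : (Fin m → ℝ) → H) (θ : Fin m → ℝ) : Matrix (Fin m) (Fin m) ℝ :=
  (gram φ θ).map Complex.im

/-! ### Multiplication by the imaginary unit -/

/-- The tangent space of the model at `θ`, represented by the real span of the horizontal lifts;
its metric is `Re ⟨· | ·⟩`. -/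
abbrev tangent (φ : (Fin m → ℝ) → H) (θ : Fin m → ℝ) : Submodule ℝ H :=
  Submodule.span ℝ (Set.range (horizontalLift φ θ))

instance (φ : (Fin m → ℝ) → H) (θ : Fin m → ℝ) : FiniteDimensional ℝ (tangent φ θ) :=
  FiniteDimensional.span_of_finite ℝ (Set.finite_range _)

/-- The map `D` of the tangent space: multiply the lift by `i`, then project orthogonally, with
respect to the metric `Re ⟨· | ·⟩`, onto the tangent space. -/
def mulI (φ : (Fin m → ℝ) → H) (θ : Fin m → ℝ) : tangent φ θ →ₗ[ℝ] tangent φ θ :=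
  letI : InnerProductSpace ℝ H := InnerProductSpace.complexToReal
  (tangent φ θ).orthogonalProjectionOnto.toLinearMap ∘ₗ
    ((Complex.I • (LinearMap.id : H →ₗ[ℝ] H)) ∘ₗ (tangent φ θ).subtype)

/-- `D x` is the vector of the tangent space with the same inner products with it as `i x`. -/
theorem re_inner_mulI (φ : (Fin m → ℝ) → H) (θ : Fin m → ℝ) (x y : tangent φ θ) :
    (⟪(y : H), (mulI φ θ x : H)⟫_ℂ).re = (⟪(y : H), Complex.I • (x : H)⟫_ℂ).re := by
  let : InnerProductSpace ℝ H := InnerProductSpace.complexToReal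
  exact (tangent φ θ).inner_orthogonalProjectionOnto_eq_of_mem_left y (Complex.I • (x : H))

/-! ### Estimators

An estimator is a measurement with data space `ℝ^m`, the data being the estimate. -/

namespace Measurement

/-- The derivative at `θ` in direction `i` of the law of the data,
`B ↦ tr (∂_i ρ(θ) M(B)) = Re ⟨l_i | M(B) | φ⟩`, a signed measure. -/
def probDeriv (M : Measurement H (Fin m → ℝ)) (φ : (Fin m → ℝ) → H) (θ : Fin m → ℝ)
    (i : Fin m) : SignedMeasure (Fin m → ℝ) :=
  M.reInner (horizontalLift φ θ i) (φ θ)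

/-- `probDeriv` is the derivative of the law of the data. -/
theorem fderiv_prob (M : Measurement H (Fin m → ℝ)) {φ : (Fin m → ℝ) → H} {θ : Fin m → ℝ}
    (hunit : ∀ᶠ η in 𝓝 θ, ‖φ η‖ = 1) (hφ : DifferentiableAt ℝ φ θ) (i : Fin m)
    {B : Set (Fin m → ℝ)} (hB : MeasurableSet B) :
    fderiv ℝ (fun η => (M.prob (φ η)).real B) θ (Pi.single i 1) = M.probDeriv φ θ i B := by
  have hpos := M.isPositive B hB
  have h1 : (fun η => (M.prob (φ η)).real B) = fun η => (⟪φ η, M.op B (φ η)⟫_ℂ).re := by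
    funext η
    have h0 : 0 ≤ (⟪φ η, M.op B (φ η)⟫_ℂ).re := hpos.re_inner_nonneg_right _
    rw [Measure.real, M.prob_apply _ hB, ENNReal.toReal_ofReal h0]
  have h2 : HasFDerivAt (fun η => M.op B (φ η)) _ θ :=
    ((M.op B).restrictScalars ℝ).hasFDerivAt.comp θ hφ.hasFDerivAt
  have h3 : HasFDerivAt (fun η => (⟪φ η, M.op B (φ η)⟫_ℂ).re) _ θ :=
    Complex.reCLM.hasFDerivAt.comp θ (hφ.hasFDerivAt.inner ℂ h2)
  rw [h1, h3.fderiv, probDeriv, reInner_apply _ _ _ hB]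
  have hre := re_inner_partialDeriv hunit hφ i
  have him : (⟪φ θ, M.op B (φ θ)⟫_ℂ).im = 0 := by
    rw [← Complex.conj_eq_iff_im, inner_conj_symm]
    exact hpos.isSymmetric (φ θ) (φ θ)
  have hsymm : (⟪φ θ, M.op B (partialDeriv φ θ i)⟫_ℂ).re =
      (⟪partialDeriv φ θ i, M.op B (φ θ)⟫_ℂ).re := by
    have h4 : ⟪M.op B (φ θ), partialDeriv φ θ i⟫_ℂ = ⟪φ θ, M.op B (partialDeriv φ θ i)⟫_ℂ :=
      hpos.isSymmetric (φ θ) (partialDeriv φ θ i)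
    rw [← h4, ← inner_conj_symm, Complex.conj_re]
  have hre' : (⟪partialDeriv φ θ i, φ θ⟫_ℂ).re = 0 := by
    rw [← inner_conj_symm, Complex.conj_re, hre]
  have hL : (⟪horizontalLift φ θ i, M.op B (φ θ)⟫_ℂ).re =
      2 * (⟪partialDeriv φ θ i, M.op B (φ θ)⟫_ℂ).re := by
    simp [horizontalLift, inner_smul_left, inner_sub_left, him, hre']
    ring
  rw [hL, two_mul]
  nth_rewrite 1 [← hsymm]
  simp [fderivInnerCLM_apply, partialDeriv]

/-- Local unbiasedness at `θ`: the estimate has finite variance, `E_θ[θ̂] = θ`, and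
`∂_i E_θ[θ̂^j] = δ_i^j`, the derivative being that of the law of the data, i.e.
`∂_i E_θ[θ̂^j] = ∫ θ̂^j tr (∂_i ρ(θ) M(dθ̂))`. -/
structure LocallyUnbiased (M : Measurement H (Fin m → ℝ)) (φ : (Fin m → ℝ) → H)
    (θ : Fin m → ℝ) : Prop where
  memLp : ∀ j, MemLp (fun x : Fin m → ℝ => x j) 2 (M.prob (φ θ))
  mean : ∀ j, ∫ x, x j ∂(M.prob (φ θ)) = θ j
  integrable : ∀ i j, (M.probDeriv φ θ i).Integrable (fun x : Fin m → ℝ => x j)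
  deriv : ∀ i j, ∫ᵛ x, x j ∂•(M.probDeriv φ θ i) = if i = j then 1 else 0

/-- Local unbiasedness where moreover the mean `E_η[θ̂]` exists for all `η` near `θ` and is
differentiable at `θ`, with derivative the identity. -/
structure StronglyLocallyUnbiased (M : Measurement H (Fin m → ℝ)) (φ : (Fin m → ℝ) → H)
    (θ : Fin m → ℝ) : Prop extends M.LocallyUnbiased φ θ where
  mean_integrable : ∀ᶠ η in 𝓝 θ, ∀ j, Integrable (fun x : Fin m → ℝ => x j) (M.prob (φ η))
  mean_hasFDerivAt : ∀ j, HasFDerivAt (fun η => ∫ x, x j ∂(M.prob (φ η)))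
    (ContinuousLinearMap.proj j : (Fin m → ℝ) →L[ℝ] ℝ) θ

/-- The matrix `V_θ[M]` of second moments about `θ`; the covariance matrix if `E_θ[θ̂] = θ`. -/
def cov (M : Measurement H (Fin m → ℝ)) (φ : (Fin m → ℝ) → H) (θ : Fin m → ℝ) :
    Matrix (Fin m) (Fin m) ℝ :=
  Matrix.of fun i j => ∫ x, (x i - θ i) * (x j - θ j) ∂(M.prob (φ θ))

end Measurement

/-- The set `𝒱_θ` of the covariance matrices of the locally unbiased estimators at `θ`. -/
def covRegion (φ : (Fin m → ℝ) → H) (θ : Fin m → ℝ) : Set (Matrix (Fin m) (Fin m) ℝ) :=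
  {V | ∃ M : Measurement H (Fin m → ℝ), M.LocallyUnbiased φ θ ∧ V = M.cov φ θ}

/-- The same with the stronger notion of local unbiasedness. -/
def strongCovRegion (φ : (Fin m → ℝ) → H) (θ : Fin m → ℝ) : Set (Matrix (Fin m) (Fin m) ℝ) :=
  {V | ∃ M : Measurement H (Fin m → ℝ), M.StronglyLocallyUnbiased φ θ ∧ V = M.cov φ θ}

/-- `c = min {Tr G V | V ∈ 𝒱}` (the minimum exists and equals `c`). -/
def IsCRBound (G : Matrix (Fin m) (Fin m) ℝ) (𝒱 : Set (Matrix (Fin m) (Fin m) ℝ)) (c : ℝ) : Prop :=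
  IsLeast ((fun V => (G * V).trace) '' 𝒱) c

/-! ### The closed form -/

/-- The nonnegative square root of a nonnegative Hermitian matrix, by functional calculus. -/
def msqrt {𝕜 : Type*} [RCLike 𝕜] (A : Matrix (Fin m) (Fin m) 𝕜) : Matrix (Fin m) (Fin m) 𝕜 :=
  cfc Real.sqrt A

/-- The skew matrix in orthonormal coordinates, `J^{S -1/2} J̃ J^{S -1/2}`. -/
def normSkew (φ : (Fin m → ℝ) → H) (θ : Fin m → ℝ) : Matrix (Fin m) (Fin m) ℝ :=
  (msqrt (fisher φ θ))⁻¹ * skew φ θ * (msqrt (fisher φ θ))⁻¹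

/-- `Tr {Re (I + i J^{S -1/2} J̃ J^{S -1/2})^{1/2}}^{-2}`. -/
def traceFormula (φ : (Fin m → ℝ) → H) (θ : Fin m → ℝ) : ℝ :=
  ((((msqrt (1 + Complex.I • (normSkew φ θ).map Complex.ofReal)).map Complex.re)⁻¹) ^ 2).trace

/-- `∑ 2 / (1 + √(1 - |α|²))` over the complex eigenvalues `α` of `D`, with multiplicity. -/
def eigenvalueSum (φ : (Fin m → ℝ) → H) (θ : Fin m → ℝ) : ℝ :=
  (((mulI φ θ).charpoly.aroots ℂ).map fun α => 2 / (1 + √(1 - ‖α‖ ^ 2))).sum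

end PureStateEstimation

end

noncomputable section

namespace PureStateEstimation

open MeasureTheory Matrix
open scoped ENNReal Topology InnerProductSpace

/-! ### Functional calculus of Hermitian matrices -/

section FunctionalCalculus

variable {n 𝕜 : Type*} [Fintype n] [DecidableEq n] [RCLike 𝕜] {A : Matrix n n ℂ}

/-! In coordinates where `J^S` is the identity, the Gram matrix of the lifts is `1 + A`, with `A = i
N` (`genMatrix`) Hermitian and purely imaginary. So entrywise conjugation sends `f(A)` to `f(-A)`,
the real part of `f(A)` is the even part of `f` at `A`, and `R = Re √(1 + A)` is `rad(A)`. The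
spectrum of `A` is symmetric and lies in `[-1, 1]`.

Lower bound. Replace the error `x - θ` by a simple function. The lifts and the vector-valued moments
of the estimate then have a positive joint Gram matrix with blocks `1 + A`, `X`, `Xᴴ`, `W`, where
`W` is real because the outcomes commute as classical data. For Hermitian `a`, `b`, positivity gives
`2 Re Tr(b a X) ≤ Tr(a² (1 + A)) + Tr(b² W)` (`trace_block_nonneg`). Since `W` is real symmetric,
`b² = f(A)` is invisible in the last term as soon as the even part of `f` is `1`. Taking `b a = R⁻²`
and, up to a regularization, `f = √(1 + x) / rad x`, the right side becomes `Tr R⁻² + Tr W`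
(`lower_bound`). Local unbiasedness makes `Re X` tend to `1`, hence `Tr R⁻² ≤ Tr J^S V` in the
limit.

Attainment. The vectors `p = 𝖫 J^{S -1/2} (1 + A)^{-1/2}`, with a pseudo-inverse square root, have a
projection as Gram matrix, and `Re ⟨l | p⟩ = J^{S 1/2} R`. `exists_stronglyLocallyUnbiased` turns
them into a measurement with finitely many outcomes and covariance `Yᵀ Y`, where `Y = R⁻¹ J^{S
-1/2}`. Its cost is exactly `Tr R⁻²`, and it is unbiased in the stronger sense, so one estimator
serves both minima.

The eigenvalue formula follows because `D` is similar to `-N = i A`, and `(rad x)⁻² = 2 / (1 + √(1 -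
x²))` on `[-1, 1]`. -/

theorem continuousOn_spectrum (A : Matrix n n 𝕜) (f : ℝ → ℝ) : ContinuousOn f (spectrum ℝ A) :=
  Matrix.finite_real_spectrum.continuousOn f

theorem cfc_mul_cfc (A : Matrix n n 𝕜) (f g : ℝ → ℝ) :
    cfc f A * cfc g A = cfc (fun x => f x * g x) A :=
  (cfc_mul f g A (continuousOn_spectrum A f) (continuousOn_spectrum A g)).symm

theorem conjTranspose_cfc (A : Matrix n n 𝕜) (f : ℝ → ℝ) : (cfc f A)ᴴ = cfc f A :=
  (cfc_predicate f A : IsSelfAdjoint (cfc f A))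

theorem trace_cfc (hA : A.IsHermitian) (f : ℝ → ℝ) :
    (cfc f A).trace = ((∑ i, f (hA.eigenvalues i) : ℝ) : ℂ) := by
  rw [hA.cfc_eq, Matrix.IsHermitian.cfc, Unitary.conjStarAlgAut_apply, Matrix.trace_mul_comm,
    ← Matrix.mul_assoc]
  simp [Matrix.trace]

theorem cfc_congr_eigenvalues {A : Matrix n n 𝕜} (hA : A.IsHermitian) {f g : ℝ → ℝ}
    (h : ∀ i, f (hA.eigenvalues i) = g (hA.eigenvalues i)) : cfc f A = cfc g A := by
  apply cfc_congr
  rw [hA.spectrum_real_eq_range_eigenvalues]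
  rintro _ ⟨i, rfl⟩
  exact h i

/-- Entrywise complex conjugation of matrices, as a star algebra homomorphism over `ℝ`. -/
def conjHom (n : Type*) [Fintype n] [DecidableEq n] : Matrix n n ℂ →⋆ₐ[ℝ] Matrix n n ℂ where
  toFun M := M.map (starRingEnd ℂ)
  map_one' := by ext i j; by_cases h : i = j <;> simp [Matrix.one_apply, h]
  map_mul' M N := by simp [Matrix.map_mul]
  map_zero' := by simp
  map_add' M N := by ext; simp
  commutes' c := by ext i j; by_cases h : i = j <;> simp [Matrix.algebraMap_matrix_apply, h]
  map_star' M := by ext; simp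

/-- Conjugation is a real star algebra homomorphism, so it commutes with the functional calculus,
and it sends `A` to `-A`. -/
theorem conj_cfc (hA : A.IsHermitian) (hc : A.map (starRingEnd ℂ) = -A) (f : ℝ → ℝ) :
    (cfc f A).map (starRingEnd ℂ) = cfc (fun x => f (-x)) A := by
  have h1 := StarAlgHom.map_cfc (R := ℝ) (conjHom n) f A (continuousOn_spectrum A f)
    (by
      change Continuous fun M : Matrix n n ℂ => M.map (starRingEnd ℂ)
      exact continuous_id.matrix_map Complex.continuous_conj)
    hA (by
      change IsSelfAdjoint (A.map (starRingEnd ℂ))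
      rw [hc]; exact IsSelfAdjoint.neg hA)
  change (cfc f A).map (starRingEnd ℂ) = cfc f (A.map (starRingEnd ℂ)) at h1
  rw [h1, hc, cfc_comp_neg f A ?_ hA.isSelfAdjoint]
  exact (Matrix.finite_real_spectrum.image _).continuousOn f

theorem add_conj_eq {n : Type*} (M : Matrix n n ℂ) :
    M + M.map (starRingEnd ℂ) = (2 : ℝ) • (M.map Complex.re).map Complex.ofReal := by
  ext i j
  simp [Complex.add_conj]

theorem map_re_cfc (hA : A.IsHermitian) (hc : A.map (starRingEnd ℂ) = -A) (f : ℝ → ℝ) :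
    ((cfc f A).map Complex.re).map Complex.ofReal = cfc (fun x => (f x + f (-x)) / 2) A := by
  have h1 : cfc f A + cfc (fun x => f (-x)) A =
      (2 : ℝ) • cfc (fun x => (f x + f (-x)) / 2) A := by
    rw [← cfc_add A f _ (continuousOn_spectrum A _) (continuousOn_spectrum A _),
      ← cfc_smul (2 : ℝ) _ A (continuousOn_spectrum A _)]
    congr 1
    funext x
    simp only [smul_eq_mul]
    ring
  rw [← conj_cfc hA hc, add_conj_eq] at h1
  exact smul_right_injective _ (two_ne_zero (α := ℝ)) h1

theorem map_re_cfc_of_even (hA : A.IsHermitian) (hc : A.map (starRingEnd ℂ) = -A) {f : ℝ → ℝ}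
    (hf : ∀ x, f (-x) = f x) : ((cfc f A).map Complex.re).map Complex.ofReal = cfc f A := by
  rw [map_re_cfc hA hc]
  congr 1
  funext x
  rw [hf]
  ring

theorem trace_map_ofReal {n : Type*} [Fintype n] (M : Matrix n n ℝ) : (M.map Complex.ofReal).trace = (M.trace : ℂ) := by
  simp [Matrix.trace]

/-- The trace of `f(A)` is real, hence unchanged by conjugation, which replaces `f(x)` by `f(-x)`.
This is the symmetry of the spectrum of `A`. -/
theorem sum_eigenvalues_neg (hA : A.IsHermitian) (hc : A.map (starRingEnd ℂ) = -A) (f : ℝ → ℝ) :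
    ∑ i, f (-hA.eigenvalues i) = ∑ i, f (hA.eigenvalues i) := by
  have h1 := congrArg Matrix.trace (conj_cfc hA hc f)
  rw [trace_cfc hA] at h1
  have h2 : ((cfc f A).map (starRingEnd ℂ)).trace = (starRingEnd ℂ) (cfc f A).trace := by
    simp [Matrix.trace]
  rw [h2, trace_cfc hA, Complex.conj_ofReal] at h1
  exact_mod_cast h1.symm

end FunctionalCalculus

/-! ### The optimal value -/

/-- The function whose value at `A` is the real part of `√(1 + A)` when `A` is purely imaginary. -/
def rad (x : ℝ) : ℝ := (√(1 + x) + √(1 - x)) / 2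

theorem rad_neg (x : ℝ) : rad (-x) = rad x := by
  simp [rad, add_comm, sub_eq_add_neg]

theorem rad_pos (x : ℝ) : 0 < rad x := by
  have h1 := Real.sqrt_nonneg (1 + x)
  have h2 := Real.sqrt_nonneg (1 - x)
  unfold rad
  rcases le_total 0 x with h | h
  · have := Real.sqrt_pos.2 (show 0 < 1 + x by linarith)
    linarith
  · have := Real.sqrt_pos.2 (show 0 < 1 - x by linarith)
    linarith

theorem rad_sq_inv {x : ℝ} (h1 : -1 ≤ x) (h2 : x ≤ 1) :
    (rad x ^ 2)⁻¹ = 2 / (1 + √(1 - x ^ 2)) := by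
  have h3 : √(1 - x ^ 2) = √(1 + x) * √(1 - x) := by
    rw [← Real.sqrt_mul (by linarith)]
    congr 1
    ring
  have h4 := Real.sq_sqrt (show 0 ≤ 1 + x by linarith)
  have h5 := Real.sq_sqrt (show 0 ≤ 1 - x by linarith)
  have h6 : rad x ^ 2 = (1 + √(1 - x ^ 2)) / 2 := by
    rw [h3, rad]
    linear_combination (1 / 4) * h4 + (1 / 4) * h5
  rw [h6, inv_div]

/-! ### Trace duality for positive block matrices. -/

section LowerBound

open scoped ComplexOrder

variable {n : Type*} [Fintype n] [DecidableEq n] {A : Matrix n n ℂ}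

theorem trace_fromBlocks {n m R : Type*} [Fintype n] [Fintype m] [AddCommMonoid R] (P : Matrix m m R)
    (X : Matrix m n R) (Y : Matrix n m R) (Q : Matrix n n R) :
    (fromBlocks P X Y Q).trace = P.trace + Q.trace := by
  simp [Matrix.trace]

/-- Compress the block matrix by the column with entries `-a` and `b`, and take the trace of the
resulting positive matrix: a matrix form of `2 u v ≤ u² + v²`. -/
theorem trace_block_nonneg {n : Type*} [Fintype n] {P Q X Y : Matrix n n ℂ} (h : (fromBlocks P X Xᴴ Q).PosSemidef)
    {a b : Matrix n n ℂ} (ha : aᴴ = a) (hb : bᴴ = b) (hY : b * a = Y) :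
    2 * (Y * X).trace.re ≤ (a * a * P).trace.re + (b * b * Q).trace.re := by
  have h1 := (h.conjTranspose_mul_mul_same (fromBlocks (-a) 0 b 0 : Matrix (n ⊕ n) (n ⊕ n) ℂ)).trace_nonneg
  have h2 := (Complex.le_def.1 h1).1
  rw [fromBlocks_conjTranspose, fromBlocks_multiply, fromBlocks_multiply, trace_fromBlocks] at h2
  simp only [conjTranspose_neg, ha, hb, conjTranspose_zero, Matrix.zero_mul, Matrix.mul_zero,
    add_zero, Matrix.trace_zero, Complex.zero_re, Matrix.neg_mul, Matrix.mul_neg, Matrix.add_mul,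
    Matrix.trace_add, Matrix.trace_neg, Complex.add_re, Complex.neg_re] at h2
  have e1 : (a * P * a).trace = (a * a * P).trace := by
    rw [Matrix.trace_mul_comm, Matrix.mul_assoc]
  have e2 : (b * Q * b).trace = (b * b * Q).trace := by
    rw [Matrix.trace_mul_comm, Matrix.mul_assoc]
  have e3 : (a * X * b).trace = (Y * X).trace := by
    rw [Matrix.trace_mul_comm, ← Matrix.mul_assoc, hY]
  have e4 : (b * Xᴴ * a).trace.re = (Y * X).trace.re := by
    have : (b * Xᴴ * a) = (a * X * b)ᴴ := by
      simp [Matrix.conjTranspose_mul, ha, hb, Matrix.mul_assoc]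
    rw [this, Matrix.trace_conjTranspose, e3]
    simp
  rw [e1, e2, e3, e4] at h2
  linarith

/-- The ideal weight `√(1 + x) / rad x` has even part `1` but vanishes at `x = -1`, where it cannot
be divided by. Mixing it with the constant `1` keeps the even part and makes it strictly positive,
at the price of the factor `t⁻¹`. -/
theorem lower_bound_aux (hA : A.IsHermitian) (hc : A.map (starRingEnd ℂ) = -A)
    (hpos : ∀ i, -1 ≤ hA.eigenvalues i) {X : Matrix n n ℂ} {W : Matrix n n ℝ}
    (h : (fromBlocks (1 + A) X Xᴴ (W.map Complex.ofReal)).PosSemidef)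
    {t : ℝ} (ht0 : 0 < t) (ht1 : t < 1) :
    2 * (cfc (fun x => (rad x ^ 2)⁻¹) A * X).trace.re ≤
      t⁻¹ * (cfc (fun x => (rad x ^ 2)⁻¹) A).trace.re + W.trace := by
  set f : ℝ → ℝ := fun x => (1 - t) + t * (√(1 + x) / rad x) with hf
  have hfpos : ∀ x, 0 < f x := fun x => by
    have : 0 ≤ t * (√(1 + x) / rad x) :=
      mul_nonneg ht0.le (div_nonneg (Real.sqrt_nonneg _) (rad_pos x).le)
    simp only [hf]
    linarith
  have hfadd : ∀ x, (f x + f (-x)) / 2 = 1 := fun x => by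
    have := (rad_pos x).ne'
    have h2 : √(1 + x) + √(1 + -x) = 2 * rad x := by
      simp [rad, sub_eq_add_neg]
      ring
    simp only [hf, rad_neg]
    field_simp
    linear_combination t * h2
  have hfsq : ∀ x, √(f x) ≠ 0 := fun x => (Real.sqrt_pos.2 (hfpos x)).ne'
  -- Here `b = √f(A)` and `a = (rad⁻² / √f)(A)`, so that `b a = rad⁻²(A)` whatever `f` is.
  have key := trace_block_nonneg h (Y := cfc (fun x => (rad x ^ 2)⁻¹) A)
    (conjTranspose_cfc A fun x => (rad x ^ 2)⁻¹ / √(f x))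
    (conjTranspose_cfc A fun x => √(f x))
    (by rw [cfc_mul_cfc]; congr 1; funext x; exact mul_div_cancel₀ _ (hfsq x))
  -- Against the real matrix `W` only the real part of `b² = f(A)` counts, and that is the identity.
  have h1 : (cfc (fun x => √(f x)) A * cfc (fun x => √(f x)) A * W.map Complex.ofReal).trace.re =
      W.trace := by
    have hre := map_re_cfc hA hc f
    rw [show (fun x => (f x + f (-x)) / 2) = fun _ => (1 : ℝ) from funext hfadd,
      cfc_const_one ℝ A hA.isSelfAdjoint] at hre
    have hre' : ∀ i j, (cfc f A i j).re = (1 : Matrix n n ℝ) i j := fun i j => by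
      have := congrFun (congrFun hre i) j
      simp only [map_apply] at this
      apply Complex.ofReal_injective
      rw [this]
      by_cases hij : i = j <;> simp [Matrix.one_apply, hij]
    rw [cfc_mul_cfc, show (fun x => √(f x) * √(f x)) = f from
      funext fun x => Real.mul_self_sqrt (hfpos x).le]
    simp only [Matrix.trace, diag_apply, mul_apply, map_apply, Complex.re_sum, Complex.re_mul_ofReal,
      hre']
    simp [Matrix.one_apply]
  have h2 : (cfc (fun x => (rad x ^ 2)⁻¹ / √(f x)) A * cfc (fun x => (rad x ^ 2)⁻¹ / √(f x)) A *
      (1 + A)).trace.re ≤ t⁻¹ * (cfc (fun x => (rad x ^ 2)⁻¹) A).trace.re := by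
    have hA1 : 1 + A = cfc (fun x : ℝ => 1 + x) A := by
      rw [cfc_const_add (1 : ℝ) (fun x => x) A (continuousOn_spectrum A _)
      hA.isSelfAdjoint, cfc_id' ℝ A hA.isSelfAdjoint]
      simp
    rw [hA1, cfc_mul_cfc, cfc_mul_cfc, trace_cfc hA, trace_cfc hA, Complex.ofReal_re,
      Complex.ofReal_re]
    -- Averaging over `x` and `-x` replaces `√(1 + x)` by `rad x`; the symmetry of the spectrum
    -- makes this averaging free.
    have h3 : ∑ i, (rad (hA.eigenvalues i) ^ 2)⁻¹ =
        ∑ i, √(1 + hA.eigenvalues i) * (rad (hA.eigenvalues i) ^ 3)⁻¹ := by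
      have h4 := sum_eigenvalues_neg hA hc fun x => √(1 + x) * (rad x ^ 3)⁻¹
      have h5 : ∑ i, (rad (hA.eigenvalues i) ^ 2)⁻¹ =
          (∑ i, √(1 + hA.eigenvalues i) * (rad (hA.eigenvalues i) ^ 3)⁻¹ +
            ∑ i, √(1 + -hA.eigenvalues i) * (rad (-hA.eigenvalues i) ^ 3)⁻¹) / 2 := by
        rw [← Finset.sum_add_distrib, Finset.sum_div]
        refine Finset.sum_congr rfl fun i _ => ?_
        have := (rad_pos (hA.eigenvalues i)).ne'
        have h2 : √(1 + hA.eigenvalues i) + √(1 + -hA.eigenvalues i) =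
            2 * rad (hA.eigenvalues i) := by
          simp [rad, sub_eq_add_neg]
          ring
        rw [rad_neg, ← add_mul, h2]
        field_simp
      rw [h5, h4]
      ring
    rw [h3, Finset.mul_sum]
    refine Finset.sum_le_sum fun i _ => ?_
    set x := hA.eigenvalues i
    have hr := rad_pos x
    have hq := Real.sqrt_nonneg (1 + x)
    have hqq := Real.sq_sqrt (show 0 ≤ 1 + x by linarith [hpos i])
    have e1 : (rad x ^ 2)⁻¹ / √(f x) * ((rad x ^ 2)⁻¹ / √(f x)) * (1 + x) =
        √(1 + x) ^ 2 / (rad x ^ 4 * f x) := by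
      rw [hqq]
      have := Real.sq_sqrt (hfpos x).le
      rw [← this, Real.sqrt_sq (Real.sqrt_nonneg _)]
      have := hfsq x
      field_simp
    have e2 : t⁻¹ * (√(1 + x) * (rad x ^ 3)⁻¹) = √(1 + x) / (t * rad x ^ 3) := by
      field_simp
    rw [e1, e2, div_le_div_iff₀ (mul_pos (pow_pos hr 4) (hfpos x)) (mul_pos ht0 (pow_pos hr 3))]
    -- Dropping the nonnegative part `(1 - t) rad x` of `rad x * f x` is the only loss; it
    -- disappears as `t → 1`.
    have e3 : t * √(1 + x) ≤ rad x * f x := by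
      have : rad x * f x = (1 - t) * rad x + t * √(1 + x) := by
        simp only [hf]
        field_simp
      rw [this]
      nlinarith
    calc √(1 + x) ^ 2 * (t * rad x ^ 3) = (√(1 + x) * rad x ^ 3) * (t * √(1 + x)) := by ring
      _ ≤ (√(1 + x) * rad x ^ 3) * (rad x * f x) :=
        mul_le_mul_of_nonneg_left e3 (mul_nonneg hq (pow_pos hr 3).le)
      _ = √(1 + x) * (rad x ^ 4 * f x) := by ring
  linarith

/-- The dual bound: the trace of a real Gram matrix `W` of vectors `y`, when the mutual Gram
matrix of `e` and `y` is `X` and that of the vectors `e` is `1 + A`. -/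
theorem lower_bound (hA : A.IsHermitian) (hc : A.map (starRingEnd ℂ) = -A)
    (hpos : ∀ i, -1 ≤ hA.eigenvalues i) {X : Matrix n n ℂ} {W : Matrix n n ℝ}
    (h : (fromBlocks (1 + A) X Xᴴ (W.map Complex.ofReal)).PosSemidef) :
    2 * (cfc (fun x => (rad x ^ 2)⁻¹) A * X).trace.re ≤
      (cfc (fun x => (rad x ^ 2)⁻¹) A).trace.re + W.trace := by
  have h1 : Filter.Tendsto (fun t : ℝ => t⁻¹ * (cfc (fun x => (rad x ^ 2)⁻¹) A).trace.re + W.trace)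
      (𝓝[<] 1) (𝓝 ((1 : ℝ)⁻¹ * (cfc (fun x => (rad x ^ 2)⁻¹) A).trace.re + W.trace)) :=
    (((tendsto_inv₀ one_ne_zero).mono_left nhdsWithin_le_nhds).mul_const _).add_const _
  rw [inv_one, one_mul] at h1
  refine ge_of_tendsto h1 ?_
  filter_upwards [Ioo_mem_nhdsLT (zero_lt_one (α := ℝ))] with t ht
  exact lower_bound_aux hA hc hpos h ht.1 ht.2

end LowerBound

/-! ### Orthonormal coordinates of the tangent space -/

theorem map_ofReal_mul {l n o : Type*} [Fintype n] (M : Matrix l n ℝ) (N : Matrix n o ℝ) :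
    (M * N).map Complex.ofReal = M.map Complex.ofReal * N.map Complex.ofReal :=
  Matrix.map_mul (f := Complex.ofRealHom)

theorem map_ofReal_one {n : Type*} [DecidableEq n] :
    (1 : Matrix n n ℝ).map Complex.ofReal = 1 :=
  Matrix.map_one Complex.ofReal Complex.ofReal_zero Complex.ofReal_one

theorem map_ofReal_injective {l n : Type*} :
    Function.Injective fun M : Matrix l n ℝ => M.map Complex.ofReal :=
  Matrix.map_injective Complex.ofReal_injective

section

variable {m : ℕ} {𝕜 : Type*} [RCLike 𝕜]

open scoped ComplexOrder

theorem conjTranspose_msqrt (J : Matrix (Fin m) (Fin m) 𝕜) : (msqrt J)ᴴ = msqrt J :=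
  conjTranspose_cfc J _

theorem msqrt_mul_self {J : Matrix (Fin m) (Fin m) 𝕜} (hJ : J.PosSemidef) :
    msqrt J * msqrt J = J := by
  rw [msqrt, cfc_mul_cfc, cfc_congr_eigenvalues hJ.1 (g := fun x => x)
    fun i => Real.mul_self_sqrt (hJ.eigenvalues_nonneg i), cfc_id' ℝ J hJ.1.isSelfAdjoint]

theorem isUnit_det_msqrt {J : Matrix (Fin m) (Fin m) 𝕜} (hJ : J.PosDef) :
    IsUnit (msqrt J).det := by
  have h1 : IsUnit (msqrt J * msqrt J).det := by
    rw [msqrt_mul_self hJ.posSemidef]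
    exact (Matrix.isUnit_iff_isUnit_det _).1 hJ.isUnit
  rw [Matrix.det_mul] at h1
  exact isUnit_of_mul_isUnit_left h1

end

/-! ### The spectrum of `A` lies in `[-1, 1]`. -/

section EigenvalueBounds

open scoped ComplexOrder

variable {n : Type*} [Fintype n] [DecidableEq n] {A : Matrix n n ℂ}

theorem neg_one_le_eigenvalues (hA : A.IsHermitian) (h : (1 + A).PosSemidef) (i : n) :
    -1 ≤ hA.eigenvalues i := by
  have h1 := (Complex.le_def.1
    (h.dotProduct_mulVec_nonneg (hA.eigenvectorBasis i).ofLp)).1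
  rw [Matrix.add_mulVec, Matrix.one_mulVec, dotProduct_add, Complex.add_re] at h1
  have h2 := hA.eigenvalues_eq i
  have h3 : (star (hA.eigenvectorBasis i).ofLp ⬝ᵥ (hA.eigenvectorBasis i).ofLp).re = 1 := by
    have h4 := hA.eigenvectorBasis.orthonormal.1 i
    have h5 : inner ℂ (hA.eigenvectorBasis i) (hA.eigenvectorBasis i) = 1 := by
      rw [inner_self_eq_norm_sq_to_K, h4]; simp
    rw [EuclideanSpace.inner_eq_star_dotProduct, dotProduct_comm] at h5
    rw [h5, Complex.one_re]
  rw [h3] at h1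
  change _ = Complex.re _ at h2
  rw [← h2, Complex.zero_re] at h1
  linarith

/-- The transpose of `1 + A` is `1 - A`, and transposition preserves positivity; so the lower bound
on eigenvalues applies to `-A` too. -/
theorem eigenvalues_le_one (hA : A.IsHermitian) (hc : A.map (starRingEnd ℂ) = -A)
    (h : (1 + A).PosSemidef) (i : n) : hA.eigenvalues i ≤ 1 := by
  have h1 : Aᵀ = -A := by
    rw [← hc]
    nth_rewrite 1 [← hA.eq]
    ext; simp
  have h2 : (1 + -A).PosSemidef := by
    rw [← h1, ← Matrix.transpose_one (n := n) (α := ℂ), ← Matrix.transpose_add]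
    exact h.transpose
  have h3 := (Complex.le_def.1
    (h2.dotProduct_mulVec_nonneg (hA.eigenvectorBasis i).ofLp)).1
  rw [Matrix.add_mulVec, Matrix.one_mulVec, Matrix.neg_mulVec, dotProduct_add, dotProduct_neg,
    Complex.add_re, Complex.neg_re] at h3
  have h4 := hA.eigenvalues_eq i
  have h5 : (star (hA.eigenvectorBasis i).ofLp ⬝ᵥ (hA.eigenvectorBasis i).ofLp).re = 1 := by
    have h4 := hA.eigenvectorBasis.orthonormal.1 i
    have h5 : inner ℂ (hA.eigenvectorBasis i) (hA.eigenvectorBasis i) = 1 := by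
      rw [inner_self_eq_norm_sq_to_K, h4]; simp
    rw [EuclideanSpace.inner_eq_star_dotProduct, dotProduct_comm] at h5
    rw [h5, Complex.one_re]
  rw [h5] at h3
  change _ = Complex.re _ at h4
  rw [← h4, Complex.zero_re] at h3
  linarith

end EigenvalueBounds

/-! ### The Gram matrix of the lifts and the matrix `R` in orthonormal coordinates. -/

section Model

open scoped ComplexOrder

variable {H : Type*} [NormedAddCommGroup H] [InnerProductSpace ℂ H] {m : ℕ}
  {φ : (Fin m → ℝ) → H} {θ : Fin m → ℝ}

theorem fisher_posDef (hreg : LinearIndependent ℝ (horizontalLift φ θ)) :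
    (fisher φ θ).PosDef := by
  let : InnerProductSpace ℝ H := InnerProductSpace.complexToReal
  exact Matrix.posDef_gram_of_linearIndependent hreg

theorem gram_posSemidef (φ : (Fin m → ℝ) → H) (θ : Fin m → ℝ) : (gram φ θ).PosSemidef :=
  Matrix.posSemidef_gram ℂ (horizontalLift φ θ)

theorem transpose_skew (φ : (Fin m → ℝ) → H) (θ : Fin m → ℝ) : (skew φ θ)ᵀ = -skew φ θ := by
  ext i j
  have h : gram φ θ j i = (starRingEnd ℂ) (gram φ θ i j) := (inner_conj_symm _ _).symm
  simp [skew, h]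

/-- The inverse square root of the Fisher information. -/
def invSqrt (φ : (Fin m → ℝ) → H) (θ : Fin m → ℝ) : Matrix (Fin m) (Fin m) ℝ :=
  (msqrt (fisher φ θ))⁻¹

theorem transpose_invSqrt (φ : (Fin m → ℝ) → H) (θ : Fin m → ℝ) :
    (invSqrt φ θ)ᵀ = invSqrt φ θ := by
  have h := conjTranspose_msqrt (fisher φ θ)
  rw [Matrix.conjTranspose_eq_transpose_of_trivial] at h
  rw [invSqrt, Matrix.transpose_nonsing_inv, h]

theorem invSqrt_mul_fisher_mul_invSqrt (hreg : LinearIndependent ℝ (horizontalLift φ θ)) :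
    invSqrt φ θ * fisher φ θ * invSqrt φ θ = 1 := by
  have h1 := isUnit_det_msqrt (fisher_posDef hreg)
  have h2 : fisher φ θ = _ := (msqrt_mul_self (fisher_posDef hreg).posSemidef).symm
  rw [congrArg (invSqrt φ θ * ·) h2, invSqrt, ← Matrix.mul_assoc, Matrix.nonsing_inv_mul _ h1, Matrix.one_mul,
    Matrix.mul_nonsing_inv _ h1]

/-- The Hermitian matrix `i J^{S -1/2} J̃ J^{S -1/2}`. -/
def genMatrix (φ : (Fin m → ℝ) → H) (θ : Fin m → ℝ) : Matrix (Fin m) (Fin m) ℂ :=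
  Complex.I • (normSkew φ θ).map Complex.ofReal

theorem transpose_normSkew (φ : (Fin m → ℝ) → H) (θ : Fin m → ℝ) :
    (normSkew φ θ)ᵀ = -normSkew φ θ := by
  change (invSqrt φ θ * skew φ θ * invSqrt φ θ)ᵀ = -(invSqrt φ θ * skew φ θ * invSqrt φ θ)
  rw [Matrix.transpose_mul, Matrix.transpose_mul, transpose_invSqrt, transpose_skew,
    Matrix.neg_mul, Matrix.mul_neg, Matrix.mul_assoc]

theorem genMatrix_conj (φ : (Fin m → ℝ) → H) (θ : Fin m → ℝ) :
    (genMatrix φ θ).map (starRingEnd ℂ) = -genMatrix φ θ := by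
  ext i j
  simp [genMatrix]

theorem genMatrix_isHermitian (φ : (Fin m → ℝ) → H) (θ : Fin m → ℝ) :
    (genMatrix φ θ).IsHermitian := by
  ext i j
  have h := congrFun (congrFun (transpose_normSkew φ θ) i) j
  rw [Matrix.transpose_apply] at h
  simp [genMatrix, h]

theorem one_add_genMatrix (hreg : LinearIndependent ℝ (horizontalLift φ θ)) :
    1 + genMatrix φ θ =
      (invSqrt φ θ).map Complex.ofReal * gram φ θ * (invSqrt φ θ).map Complex.ofReal := by
  have h1 : gram φ θ = (fisher φ θ).map Complex.ofReal +
      Complex.I • (skew φ θ).map Complex.ofReal := by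
    ext i j
    simp only [fisher, skew, Matrix.add_apply, Matrix.smul_apply, Matrix.map_apply, smul_eq_mul]
    rw [mul_comm, Complex.re_add_im]
  rw [h1, Matrix.mul_add, Matrix.add_mul, Matrix.mul_smul, Matrix.smul_mul, ← map_ofReal_mul,
    ← map_ofReal_mul, ← map_ofReal_mul, ← map_ofReal_mul, invSqrt_mul_fisher_mul_invSqrt hreg,
    map_ofReal_one]
  rfl

theorem one_add_genMatrix_posSemidef (hreg : LinearIndependent ℝ (horizontalLift φ θ)) :
    (1 + genMatrix φ θ).PosSemidef := by
  have h1 : ((invSqrt φ θ).map Complex.ofReal)ᴴ = (invSqrt φ θ).map Complex.ofReal := by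
    nth_rewrite 2 [← transpose_invSqrt]
    ext; simp
  have h2 := (gram_posSemidef φ θ).conjTranspose_mul_mul_same ((invSqrt φ θ).map Complex.ofReal)
  rwa [h1, ← one_add_genMatrix hreg] at h2

/-- The real matrix `Re √(1 + i N)`. -/
def radMatrix (φ : (Fin m → ℝ) → H) (θ : Fin m → ℝ) : Matrix (Fin m) (Fin m) ℝ :=
  (msqrt (1 + genMatrix φ θ)).map Complex.re

theorem one_add_genMatrix_eq_cfc (φ : (Fin m → ℝ) → H) (θ : Fin m → ℝ) :
    1 + genMatrix φ θ = cfc (fun x : ℝ => 1 + x) (genMatrix φ θ) := by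
  rw [cfc_const_add (1 : ℝ) (fun x => x) _ (continuousOn_spectrum _ _)
    (genMatrix_isHermitian φ θ).isSelfAdjoint, cfc_id' ℝ _ (genMatrix_isHermitian φ θ).isSelfAdjoint]
  simp

theorem msqrt_one_add_genMatrix (φ : (Fin m → ℝ) → H) (θ : Fin m → ℝ) :
    msqrt (1 + genMatrix φ θ) = cfc (fun x => √(1 + x)) (genMatrix φ θ) := by
  rw [msqrt, one_add_genMatrix_eq_cfc, cfc_comp' Real.sqrt (fun x : ℝ => 1 + x) _
    Real.continuous_sqrt.continuousOn (continuousOn_spectrum _ _)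
    (genMatrix_isHermitian φ θ).isSelfAdjoint]

theorem radMatrix_map (φ : (Fin m → ℝ) → H) (θ : Fin m → ℝ) :
    (radMatrix φ θ).map Complex.ofReal = cfc rad (genMatrix φ θ) := by
  rw [radMatrix, msqrt_one_add_genMatrix,
    map_re_cfc (genMatrix_isHermitian φ θ) (genMatrix_conj φ θ)]
  rfl

/-- Both `rad` and its reciprocal are even, so their values at `A` are real matrices and inversion
can be done in the functional calculus. -/
theorem radMatrix_mul_eq_one (φ : (Fin m → ℝ) → H) (θ : Fin m → ℝ) :
    radMatrix φ θ * (cfc (fun x => (rad x)⁻¹) (genMatrix φ θ)).map Complex.re = 1 := by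
  apply map_ofReal_injective
  simp only [map_ofReal_mul, radMatrix_map, map_ofReal_one]
  rw [map_re_cfc_of_even (genMatrix_isHermitian φ θ) (genMatrix_conj φ θ)
    fun x => by rw [rad_neg], cfc_mul_cfc]
  rw [show (fun x => rad x * (rad x)⁻¹) = fun _ => (1 : ℝ) from
    funext fun x => mul_inv_cancel₀ (rad_pos x).ne',
    cfc_const_one ℝ _ (genMatrix_isHermitian φ θ).isSelfAdjoint]

theorem radMatrix_inv_map (φ : (Fin m → ℝ) → H) (θ : Fin m → ℝ) :
    (radMatrix φ θ)⁻¹.map Complex.ofReal = cfc (fun x => (rad x)⁻¹) (genMatrix φ θ) := by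
  rw [Matrix.inv_eq_right_inv (radMatrix_mul_eq_one φ θ),
    map_re_cfc_of_even (genMatrix_isHermitian φ θ) (genMatrix_conj φ θ) fun x => by rw [rad_neg]]

theorem isUnit_det_radMatrix (φ : (Fin m → ℝ) → H) (θ : Fin m → ℝ) :
    IsUnit (radMatrix φ θ).det :=
  Matrix.isUnit_det_of_right_inverse (radMatrix_mul_eq_one φ θ)

theorem radMatrix_inv_sq_map (φ : (Fin m → ℝ) → H) (θ : Fin m → ℝ) :
    ((radMatrix φ θ)⁻¹ ^ 2).map Complex.ofReal =
      cfc (fun x => (rad x ^ 2)⁻¹) (genMatrix φ θ) := by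
  rw [sq, map_ofReal_mul, radMatrix_inv_map, cfc_mul_cfc]
  congr 1
  funext x
  rw [sq, mul_inv]

theorem traceFormula_eq_sum (φ : (Fin m → ℝ) → H) (θ : Fin m → ℝ) :
    traceFormula φ θ = ∑ i, (rad ((genMatrix_isHermitian φ θ).eigenvalues i) ^ 2)⁻¹ := by
  have h1 : (((radMatrix φ θ)⁻¹ ^ 2).trace : ℂ) = _ :=
    (trace_map_ofReal _).symm.trans ((congrArg _ (radMatrix_inv_sq_map φ θ)).trans
      (trace_cfc (genMatrix_isHermitian φ θ) _))
  exact_mod_cast h1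

/-! ### The eigenvalues of `D` -/

/-- In the basis of lifts the matrix `T` of `D` solves `J^S T = -J̃`; conjugating `T` by the square
root of `J^S` gives `-N`. -/
theorem charpoly_mulI (hreg : LinearIndependent ℝ (horizontalLift φ θ)) :
    (mulI φ θ).charpoly = (-normSkew φ θ).charpoly := by
  let b : Module.Basis (Fin m) ℝ (tangent φ θ) := Module.Basis.span hreg
  have hb : ∀ i, (b i : H) = horizontalLift φ θ i := fun i =>
    congrArg Subtype.val (Module.Basis.span_apply hreg i)
  rw [← LinearMap.charpoly_toMatrix (mulI φ θ) b]
  set T := LinearMap.toMatrix b b (mulI φ θ) with hT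
  -- The sign comes from `Re ⟨l_i | i l_j⟩ = -Im ⟨l_i | l_j⟩`.
  have h1 : fisher φ θ * T = -skew φ θ := by
    ext i j
    have h2 := re_inner_mulI φ θ (b j) (b i)
    have h3 : mulI φ θ (b j) = ∑ k, T k j • b k := by
      simp only [hT, LinearMap.toMatrix_apply]
      exact (b.sum_repr _).symm
    rw [h3] at h2
    simp only [Submodule.coe_sum, Submodule.coe_smul, hb, inner_sum, Complex.re_sum,
      inner_smul_right] at h2
    rw [Matrix.mul_apply]
    have h4 : ∀ k, fisher φ θ i k * T k j =
        (⟪horizontalLift φ θ i, T k j • horizontalLift φ θ k⟫_ℂ).re := fun k => by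
      rw [← Complex.coe_smul, inner_smul_right, Complex.re_ofReal_mul, mul_comm]
      rfl
    simp only [h4, h2]
    simp [skew, gram]
  have hS := isUnit_det_msqrt (fisher_posDef hreg)
  have h2 : -normSkew φ θ = msqrt (fisher φ θ) * T * (msqrt (fisher φ θ))⁻¹ := by
    have h3 : -normSkew φ θ = (msqrt (fisher φ θ))⁻¹ * (-skew φ θ) * (msqrt (fisher φ θ))⁻¹ := by
      simp [normSkew]
    rw [h3, ← h1]
    nth_rewrite 2 [← msqrt_mul_self (fisher_posDef hreg).posSemidef]
    rw [← Matrix.mul_assoc, ← Matrix.mul_assoc, Matrix.nonsing_inv_mul _ hS, Matrix.one_mul]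
  rw [h2]
  have h3 := Matrix.charpoly_units_conj (Matrix.nonsingInvUnit _ hS) T
  rw [← h3]
  rfl

/-- As `-N = i A`, a unitary diagonalization of `A` gives the roots `i λ`, with `λ` the eigenvalues
of `A`. -/
theorem charpoly_neg_normSkew (φ : (Fin m → ℝ) → H) (θ : Fin m → ℝ) :
    ((-normSkew φ θ).charpoly.map (algebraMap ℝ ℂ)) =
      ∏ i, (Polynomial.X -
        Polynomial.C (Complex.I * ((genMatrix_isHermitian φ θ).eigenvalues i : ℂ))) := by
  have h1 : (-normSkew φ θ).map (algebraMap ℝ ℂ) = Complex.I • genMatrix φ θ := by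
    rw [genMatrix, smul_smul, Complex.I_mul_I]
    ext
    simp
  rw [← Matrix.charpoly_map, h1]
  set hA := genMatrix_isHermitian φ θ
  have h2 := hA.spectral_theorem
  rw [Unitary.conjStarAlgAut_apply] at h2
  rw [congrArg (fun M => (Complex.I • M).charpoly) h2, ← Matrix.smul_mul, ← Matrix.mul_smul, charpoly_mul_comm, ← Matrix.mul_assoc,
    Unitary.coe_star_mul_self, Matrix.one_mul, ← Matrix.diagonal_smul, Matrix.charpoly_diagonal]
  rfl

theorem traceFormula_eq_eigenvalueSum (hreg : LinearIndependent ℝ (horizontalLift φ θ)) :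
    traceFormula φ θ = eigenvalueSum φ θ := by
  rw [traceFormula_eq_sum, eigenvalueSum, Polynomial.aroots_def, charpoly_mulI hreg,
    charpoly_neg_normSkew]
  have h1 := Polynomial.roots_multiset_prod_X_sub_C (Finset.univ.val.map fun i =>
    Complex.I * ((genMatrix_isHermitian φ θ).eigenvalues i : ℂ))
  rw [Multiset.map_map] at h1
  change (∏ i, (Polynomial.X - Polynomial.C
    (Complex.I * ((genMatrix_isHermitian φ θ).eigenvalues i : ℂ)))).roots = _ at h1
  rw [h1, Multiset.map_map]
  refine Finset.sum_congr rfl fun i _ => ?_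
  have hpos := one_add_genMatrix_posSemidef hreg
  rw [rad_sq_inv (neg_one_le_eigenvalues _ hpos i)
    (eigenvalues_le_one _ (genMatrix_conj φ θ) hpos i)]
  simp

end Model

/-! ### Integration of simple functions -/

instance isFiniteMeasure_variation {X : Type*} [MeasurableSpace X] (ν : SignedMeasure X) :
    IsFiniteMeasure ν.variation := by
  rw [← SignedMeasure.totalVariation_eq_variation]
  infer_instance

theorem vectorIntegral_simpleFunc {X β : Type*} [MeasurableSpace X] (ν : SignedMeasure X)
    (s : SimpleFunc X β) (g : β → ℝ) :
    ∫ᵛ x, g (s x) ∂•ν = ∑ c ∈ s.range, g c * ν (s ⁻¹' {c}) := by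
  classical
  have h1 : (fun x => g (s x)) =
      fun x => ∑ c ∈ s.range, (s ⁻¹' {c}).indicator (fun _ => g c) x := by
    funext x
    rw [Finset.sum_eq_single (s x)]
    · simp
    · intro c _ hc
      exact Set.indicator_of_notMem (by simpa using hc.symm) _
    · intro h
      exact absurd (s.mem_range_self x) h
  rw [h1, VectorMeasure.integral_finsetSum]
  · refine Finset.sum_congr rfl fun c _ => ?_
    rw [VectorMeasure.integral_indicator_const _ (s.measurableSet_fiber c)]
    rfl
  · intro c _
    exact (integrable_const _).indicator (s.measurableSet_fiber c)

theorem integral_simpleFunc {X β : Type*} [MeasurableSpace X] (μ : Measure X) [IsFiniteMeasure μ]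
    (s : SimpleFunc X β) (g : β → ℝ) :
    ∫ x, g (s x) ∂μ = ∑ c ∈ s.range, g c * μ.real (s ⁻¹' {c}) := by
  have h : (ContinuousLinearMap.lsmul ℝ ℝ : ℝ →L[ℝ] ℝ →L[ℝ] ℝ).flip =
      ContinuousLinearMap.lsmul ℝ ℝ := by
    ext; simp
  rw [← VectorMeasure.integral_toSignedMeasure, h, vectorIntegral_simpleFunc]
  refine Finset.sum_congr rfl fun c _ => ?_
  rw [Measure.toSignedMeasure_apply_measurable (s.measurableSet_fiber c)]

variable {H : Type*} [NormedAddCommGroup H] [InnerProductSpace ℂ H]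

namespace Measurement

variable {Ω : Type*} [MeasurableSpace Ω]

instance isFiniteMeasure_prob (M : Measurement H Ω) (ψ : H) : IsFiniteMeasure (M.prob ψ) :=
  ⟨by rw [M.prob_apply ψ MeasurableSet.univ]; exact ENNReal.ofReal_lt_top⟩

theorem prob_real (M : Measurement H Ω) (ψ : H) {B : Set Ω} (hB : MeasurableSet B) :
    (M.prob ψ).real B = (⟪ψ, M.op B ψ⟫_ℂ).re := by
  rw [Measure.real, M.prob_apply ψ hB]
  exact ENNReal.toReal_ofReal ((M.isPositive B hB).re_inner_nonneg_right ψ)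

/-- Integrating the constant `1` against `Re ⟨u | M(·) | v⟩` gives the real part of the identity
tested on `u`; the imaginary part comes from testing on `i u`. -/
theorem sum_op_fiber {β : Type*} (M : Measurement H Ω) (s : SimpleFunc Ω β) (v : H) :
    ∑ c ∈ s.range, M.op (s ⁻¹' {c}) v = v := by
  refine ext_inner_left ℂ fun u => ?_
  have key : ∀ u : H, ∑ c ∈ s.range, (⟪u, M.op (s ⁻¹' {c}) v⟫_ℂ).re = (⟪u, v⟫_ℂ).re := fun u => by
    have h1 := vectorIntegral_simpleFunc (M.reInner u v) s fun _ => 1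
    rw [VectorMeasure.integral_const, reInner_apply _ _ _ MeasurableSet.univ, M.op_univ] at h1
    simp only [one_mul, reInner_apply M u v (s.measurableSet_fiber _)] at h1
    rw [← h1]
    simp
  rw [inner_sum]
  apply Complex.ext
  · rw [Complex.re_sum, key]
  · have h2 := key (Complex.I • u)
    simpa [inner_smul_left] using h2

end Measurement

/-! ### Gram matrices of discretized estimators -/

section Block

open scoped ComplexOrder

variable {m : ℕ}

theorem posSemidef_inner_positive {ι : Type*} [Fintype ι] {E : H →L[ℂ] H} (hE : E.IsPositive)
    (u : ι → H) : (Matrix.of fun a b => ⟪u a, E (u b)⟫_ℂ).PosSemidef := by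
  refine .of_dotProduct_mulVec_nonneg ?_ fun x => ?_
  · ext a b
    simp only [conjTranspose_apply, of_apply, RCLike.star_def, inner_conj_symm]
    exact hE.isSymmetric _ _
  · have h1 : star x ⬝ᵥ (Matrix.of fun a b => ⟪u a, E (u b)⟫_ℂ) *ᵥ x =
        ⟪∑ a, x a • u a, E (∑ a, x a • u a)⟫_ℂ := by
      simp only [dotProduct, mulVec, of_apply, map_sum, map_smul, sum_inner, inner_sum,
        inner_smul_left, inner_smul_right, Pi.star_apply, RCLike.star_def, Finset.mul_sum]
      rw [Finset.sum_comm]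
      refine Finset.sum_congr rfl fun a _ => Finset.sum_congr rfl fun b _ => ?_
      ring
    rw [h1]
    exact hE.inner_nonneg_right _

variable {φ : (Fin m → ℝ) → H} {θ : Fin m → ℝ}

/-- The joint Gram matrix of the lifts and of the vectors `∑ c_j E_c |φ⟩`. -/
theorem posSemidef_block {γ : Type*} (r : Finset γ) (E : γ → H →L[ℂ] H)
    (hE : ∀ c ∈ r, (E c).IsPositive) (hsum : ∀ v, ∑ c ∈ r, E c v = v) (x : γ → Fin m → ℝ)
    (φ : (Fin m → ℝ) → H) (θ : Fin m → ℝ) {X : Matrix (Fin m) (Fin m) ℂ}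
    {W : Matrix (Fin m) (Fin m) ℝ}
    (hX : ∀ i j, X i j = ∑ c ∈ r, (x c j : ℂ) * ⟪horizontalLift φ θ i, E c (φ θ)⟫_ℂ)
    (hW : ∀ i j, W i j = ∑ c ∈ r, x c i * x c j * (⟪φ θ, E c (φ θ)⟫_ℂ).re) :
    (fromBlocks (gram φ θ) X Xᴴ (W.map Complex.ofReal)).PosSemidef := by
  -- For each outcome `c` these vectors have a positive Gram matrix in the form `E c`. The lifts do
  -- not depend on `c`, so summing over `c` restores their plain Gram matrix.
  let u : γ → Fin m ⊕ Fin m → H := fun c =>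
    Sum.elim (horizontalLift φ θ) fun j => (x c j : ℂ) • φ θ
  have h1 : fromBlocks (gram φ θ) X Xᴴ (W.map Complex.ofReal) =
      ∑ c ∈ r, Matrix.of fun a b => ⟪u c a, E c (u c b)⟫_ℂ := by
    ext a b
    rw [Matrix.sum_apply]
    rcases a with i | i <;> rcases b with j | j
    · simp only [fromBlocks_apply₁₁, of_apply, u, Sum.elim_inl, ← inner_sum, hsum]
      rfl
    · simp [hX, u]
    · simp only [fromBlocks_apply₂₁, conjTranspose_apply, hX, of_apply, u, Sum.elim_inl,
        Sum.elim_inr, star_sum, inner_smul_left, RCLike.star_def, map_mul, Complex.conj_ofReal,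
        inner_conj_symm]
      refine Finset.sum_congr rfl fun c hc => ?_
      exact congrArg _ ((hE c hc).isSymmetric _ _)
    · simp only [fromBlocks_apply₂₂, map_apply, hW, of_apply, u, Sum.elim_inr, map_smul,
        inner_smul_left, inner_smul_right, Complex.conj_ofReal, Complex.ofReal_sum,
        Complex.ofReal_mul]
      refine Finset.sum_congr rfl fun c hc => ?_
      have h2 : ((⟪φ θ, E c (φ θ)⟫_ℂ).re : ℂ) = ⟪φ θ, E c (φ θ)⟫_ℂ := by
        rw [← Complex.conj_eq_iff_re, inner_conj_symm]
        exact (hE c hc).isSymmetric _ _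
      rw [h2]
      ring
  rw [h1]
  exact posSemidef_sum _ fun c hc => posSemidef_inner_positive (hE c hc) _

/-- Compressing by the block diagonal matrix of `J^{S -1/2}` and `J^{S 1/2}` turns the first block
into `1 + A` and absorbs the weight `J^S` into `W`. As `R⁻²` is real, only `Re X` enters the bound.
-/
theorem trace_bound_of_posSemidef_block (hreg : LinearIndependent ℝ (horizontalLift φ θ))
    {X : Matrix (Fin m) (Fin m) ℂ} {W : Matrix (Fin m) (Fin m) ℝ}
    (h : (fromBlocks (gram φ θ) X Xᴴ (W.map Complex.ofReal)).PosSemidef) :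
    2 * ((radMatrix φ θ)⁻¹ ^ 2 *
        (invSqrt φ θ * X.map Complex.re * msqrt (fisher φ θ))).trace ≤
      traceFormula φ θ + (fisher φ θ * W).trace := by
  set T := (invSqrt φ θ).map Complex.ofReal with hT
  set S := (msqrt (fisher φ θ)).map Complex.ofReal with hS
  have hTs : Tᴴ = T := by
    rw [hT]
    nth_rewrite 2 [← transpose_invSqrt]
    ext; simp
  have hSs : Sᴴ = S := by
    rw [hS]
    nth_rewrite 2 [← conjTranspose_msqrt]
    ext; simp
  have h1 := h.conjTranspose_mul_mul_same (fromBlocks T 0 0 S)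
  have h2 : (fromBlocks T 0 0 S)ᴴ * fromBlocks (gram φ θ) X Xᴴ (W.map Complex.ofReal) *
      fromBlocks T 0 0 S = fromBlocks (1 + genMatrix φ θ) (T * X * S) (T * X * S)ᴴ
        ((msqrt (fisher φ θ) * W * msqrt (fisher φ θ)).map Complex.ofReal) := by
    rw [fromBlocks_conjTranspose, fromBlocks_multiply, fromBlocks_multiply,
      one_add_genMatrix hreg, map_ofReal_mul, map_ofReal_mul]
    simp [hTs, hSs, Matrix.conjTranspose_mul, Matrix.mul_assoc, ← hT, ← hS]
  rw [h2] at h1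
  have h3 := lower_bound (genMatrix_isHermitian φ θ) (genMatrix_conj φ θ)
    (neg_one_le_eigenvalues _ (one_add_genMatrix_posSemidef hreg)) h1
  rw [← radMatrix_inv_sq_map, trace_map_ofReal, Complex.ofReal_re, Matrix.trace_mul_comm
    (msqrt (fisher φ θ) * W), ← Matrix.mul_assoc (msqrt (fisher φ θ)),
    msqrt_mul_self (fisher_posDef hreg).posSemidef] at h3
  have h4 : ∀ (P Q : Matrix (Fin m) (Fin m) ℝ) (Y : Matrix (Fin m) (Fin m) ℂ),
      (P.map Complex.ofReal * Y * Q.map Complex.ofReal).map Complex.re =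
        P * Y.map Complex.re * Q := fun P Q Y => by
    ext i j
    simp [Matrix.mul_apply]
  have h5 : ((((radMatrix φ θ)⁻¹ ^ 2).map Complex.ofReal * (T * X * S)).trace).re =
      ((radMatrix φ θ)⁻¹ ^ 2 *
        (invSqrt φ θ * X.map Complex.re * msqrt (fisher φ θ))).trace := by
    have h6 : (((radMatrix φ θ)⁻¹ ^ 2).map Complex.ofReal * (T * X * S)).map Complex.re =
        (radMatrix φ θ)⁻¹ ^ 2 * (T * X * S).map Complex.re := by
      ext i j
      simp [Matrix.mul_apply]
    rw [← h4, ← h6]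
    simp [Matrix.trace]
  rw [h5] at h3
  exact h3

end Block

/-! ### The lower bound -/

/-- Simple functions approximating the error `x - θ` of the estimate `x`. -/
def approxError {m : ℕ} (θ : Fin m → ℝ) : ℕ → SimpleFunc (Fin m → ℝ) (Fin m → ℝ) :=
  SimpleFunc.approxOn (fun x => x - θ) (measurable_id.sub_const θ) Set.univ 0 (Set.mem_univ _)

section Approximation

variable {m : ℕ} (θ : Fin m → ℝ)

theorem tendsto_approxError (x : Fin m → ℝ) (j : Fin m) :
    Filter.Tendsto (fun n => approxError θ n x j) Filter.atTop (𝓝 (x j - θ j)) :=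
  tendsto_pi_nhds.1 (SimpleFunc.tendsto_approxOn (measurable_id.sub_const θ) (Set.mem_univ _)
    (by simp) : Filter.Tendsto (fun n => approxError θ n x) Filter.atTop (𝓝 (x - θ))) j

theorem abs_approxError_le (n : ℕ) (x : Fin m → ℝ) (j : Fin m) :
    |approxError θ n x j| ≤ 2 * ∑ k, |x k - θ k| := by
  have h1 : ‖approxError θ n x‖ ≤ ‖x - θ‖ + ‖x - θ‖ :=
    SimpleFunc.norm_approxOn_zero_le (measurable_id.sub_const θ) _ x n
  have h2 : ‖x - θ‖ ≤ ∑ k, |x k - θ k| :=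
    (pi_norm_le_iff_of_nonneg (Finset.sum_nonneg fun k _ => abs_nonneg _)).2 fun k =>
      Finset.single_le_sum (f := fun k => |x k - θ k|) (fun k _ => abs_nonneg _)
        (Finset.mem_univ k)
  have h3 : |approxError θ n x j| ≤ ‖approxError θ n x‖ := norm_le_pi_norm (approxError θ n x) j
  linarith

theorem measurable_approxError (n : ℕ) (j : Fin m) :
    Measurable fun x => approxError θ n x j :=
  (measurable_pi_apply j).comp (approxError θ n).measurable

theorem tendsto_integral_approxError_mul {μ : Measure (Fin m → ℝ)} [IsFiniteMeasure μ]
    (h : ∀ k, MemLp (fun x : Fin m → ℝ => x k) 2 μ) (i j : Fin m) :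
    Filter.Tendsto (fun n => ∫ x, approxError θ n x i * approxError θ n x j ∂μ) Filter.atTop
      (𝓝 (∫ x, (x i - θ i) * (x j - θ j) ∂μ)) := by
  have hsum : MemLp (fun x : Fin m → ℝ => 2 * ∑ k, |x k - θ k|) 2 μ :=
    (memLp_finsetSum Finset.univ fun k _ => ((h k).sub (memLp_const (θ k))).abs).const_mul 2
  refine tendsto_integral_of_dominated_convergence (fun x => (2 * ∑ k, |x k - θ k|) ^ 2)
    (fun n => ((measurable_approxError θ n i).mul
      (measurable_approxError θ n j)).aestronglyMeasurable) hsum.integrable_sq ?_ ?_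
  · refine fun n => .of_forall fun x => ?_
    rw [norm_mul, sq]
    exact mul_le_mul (abs_approxError_le θ n x i) (abs_approxError_le θ n x j) (abs_nonneg _)
      ((abs_nonneg _).trans (abs_approxError_le θ n x i))
  · exact .of_forall fun x => (tendsto_approxError θ x i).mul (tendsto_approxError θ x j)

theorem tendsto_vectorIntegral_approxError {ν : SignedMeasure (Fin m → ℝ)}
    (h : ∀ k, ν.Integrable fun x : Fin m → ℝ => x k) (j : Fin m) :
    Filter.Tendsto (fun n => ∫ᵛ x, approxError θ n x j ∂•ν) Filter.atTop
      (𝓝 (∫ᵛ x, (x j - θ j) ∂•ν)) := by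
  have hsum : Integrable (fun x : Fin m → ℝ => 2 * ∑ k, |x k - θ k|) ν.variation :=
    (integrable_finsetSum Finset.univ fun k _ =>
      ((h k).sub (integrable_const (θ k))).abs).const_mul 2
  exact VectorMeasure.tendsto_integral_of_dominated_convergence _
    (fun n => (measurable_approxError θ n j).aestronglyMeasurable) hsum
    (fun n => .of_forall fun x => abs_approxError_le θ n x j)
    (.of_forall fun x => tendsto_approxError θ x j)

end Approximation

section LowerBoundModel

variable {m : ℕ} {φ : (Fin m → ℝ) → H} {θ : Fin m → ℝ}

/-- Centering at `θ` costs nothing: the derivative of the law has total mass `Re ⟨l_i | φ⟩ = 0`. -/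
theorem vectorIntegral_error (hunit : ‖φ θ‖ = 1) {M : Measurement H (Fin m → ℝ)}
    (hM : M.LocallyUnbiased φ θ) (i j : Fin m) :
    ∫ᵛ x, (x j - θ j) ∂•(M.probDeriv φ θ i) = (1 : Matrix (Fin m) (Fin m) ℝ) i j := by
  rw [VectorMeasure.integral_fun_sub (hM.integrable i j) (integrable_const (θ j)), hM.deriv,
    VectorMeasure.integral_const, Measurement.probDeriv, M.reInner_apply _ _ MeasurableSet.univ,
    M.op_univ]
  simp [inner_horizontalLift hunit, Matrix.one_apply]

theorem traceFormula_le_of_locallyUnbiased (hunit : ‖φ θ‖ = 1)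
    (hreg : LinearIndependent ℝ (horizontalLift φ θ)) {M : Measurement H (Fin m → ℝ)}
    (hM : M.LocallyUnbiased φ θ) :
    traceFormula φ θ ≤ (fisher φ θ * M.cov φ θ).trace := by
  let s := approxError θ
  let X : ℕ → Matrix (Fin m) (Fin m) ℂ := fun n => Matrix.of fun i j =>
    ∑ c ∈ (s n).range, (c j : ℂ) * ⟪horizontalLift φ θ i, M.op (s n ⁻¹' {c}) (φ θ)⟫_ℂ
  let W : ℕ → Matrix (Fin m) (Fin m) ℝ := fun n => Matrix.of fun i j =>
    ∑ c ∈ (s n).range, c i * c j * (⟪φ θ, M.op (s n ⁻¹' {c}) (φ θ)⟫_ℂ).re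
  have hbound : ∀ n, 2 * ((radMatrix φ θ)⁻¹ ^ 2 *
        (invSqrt φ θ * (X n).map Complex.re * msqrt (fisher φ θ))).trace ≤
      traceFormula φ θ + (fisher φ θ * W n).trace := fun n =>
    trace_bound_of_posSemidef_block hreg
      (posSemidef_block (s n).range (fun c => M.op (s n ⁻¹' {c}))
        (fun c _ => M.isPositive _ ((s n).measurableSet_fiber c)) (M.sum_op_fiber (s n))
        (fun c => c) φ θ (X := X n) (W := W n) (fun _ _ => rfl) fun _ _ => rfl)
  have hW : Filter.Tendsto W Filter.atTop (𝓝 (M.cov φ θ)) := by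
    refine tendsto_pi_nhds.2 fun i => tendsto_pi_nhds.2 fun j => ?_
    have h1 : ∀ n, W n i j = ∫ x, s n x i * s n x j ∂(M.prob (φ θ)) := fun n => by
      rw [integral_simpleFunc _ (s n) fun c => c i * c j]
      simp only [W, of_apply, M.prob_real _ ((s n).measurableSet_fiber _)]
    simp only [h1]
    exact tendsto_integral_approxError_mul θ hM.memLp i j
  have hX : Filter.Tendsto (fun n => (X n).map Complex.re) Filter.atTop
      (𝓝 (1 : Matrix (Fin m) (Fin m) ℝ)) := by
    refine tendsto_pi_nhds.2 fun i => tendsto_pi_nhds.2 fun j => ?_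
    have h1 : ∀ n, (X n).map Complex.re i j = ∫ᵛ x, s n x j ∂•(M.probDeriv φ θ i) := fun n => by
      rw [vectorIntegral_simpleFunc _ (s n) fun c => c j]
      simp only [X, of_apply, map_apply, Complex.re_sum, Complex.re_ofReal_mul,
        Measurement.probDeriv, M.reInner_apply _ _ ((s n).measurableSet_fiber _)]
    simp only [h1]
    rw [← vectorIntegral_error hunit hM i j]
    exact tendsto_vectorIntegral_approxError θ (hM.integrable i) j
  have hc1 : Continuous fun Y : Matrix (Fin m) (Fin m) ℝ => 2 * ((radMatrix φ θ)⁻¹ ^ 2 *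
        (invSqrt φ θ * Y * msqrt (fisher φ θ))).trace := by fun_prop
  have hc2 : Continuous fun V : Matrix (Fin m) (Fin m) ℝ =>
      traceFormula φ θ + (fisher φ θ * V).trace := by fun_prop
  -- In the limit this reads `2 Tr R⁻² ≤ Tr R⁻² + Tr J^S V`, since `Re X` tends to the identity.
  have h1 := le_of_tendsto_of_tendsto' ((hc1.tendsto _).comp hX) ((hc2.tendsto _).comp hW) hbound
  have h2 : invSqrt φ θ * 1 * msqrt (fisher φ θ) = 1 := by
    rw [Matrix.mul_one, invSqrt, Matrix.nonsing_inv_mul _ (isUnit_det_msqrt (fisher_posDef hreg))]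
  have h3 : ((radMatrix φ θ)⁻¹ ^ 2).trace = traceFormula φ θ := rfl
  rw [h2, Matrix.mul_one, h3] at h1
  linarith

end LowerBoundModel

/-! ### Measurements with finitely many outcomes -/

namespace Measurement

section Finite

variable {Ω ι : Type*} [MeasurableSpace Ω] [Fintype ι]

/-- The measurement given by finitely many positive operators `E i` summing to the identity, the
outcome `x i` being attached to `E i`. -/
def ofFinite (E : ι → H →L[ℂ] H) (hE : ∀ i, (E i).IsPositive) (hsum : ∑ i, E i = 1) (x : ι → Ω) :
    Measurement H Ω where
  op B := ∑ i, B.indicator (fun _ => E i) (x i)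
  isPositive B _ := by
    classical
    refine Finset.sum_induction _ ContinuousLinearMap.IsPositive (fun _ _ => .add)
      ContinuousLinearMap.isPositive_zero fun i _ => ?_
    by_cases h : x i ∈ B
    · simpa [h] using hE i
    · simp [h]
  op_empty := by simp
  op_univ := by simpa using hsum
  hasSum_iUnion B _ hd v := by
    simp only [_root_.sum_apply]
    refine hasSum_sum fun i _ => ?_
    by_cases h : x i ∈ ⋃ k, B k
    · obtain ⟨k, hk⟩ := Set.mem_iUnion.1 h
      have h1 : (⋃ k, B k).indicator (fun _ => E i) (x i) v =
          (B k).indicator (fun _ => E i) (x i) v := by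
        rw [Set.indicator_of_mem h, Set.indicator_of_mem hk]
      rw [h1]
      refine hasSum_single k fun l hl => ?_
      rw [Set.indicator_of_notMem fun h2 => Set.disjoint_left.1 (hd hl) h2 hk]
      rfl
    · rw [Set.indicator_of_notMem h]
      have h1 : ∀ k, x i ∉ B k := fun k hk => h (Set.mem_iUnion.2 ⟨k, hk⟩)
      simp only [Set.indicator_of_notMem (h1 _)]
      exact hasSum_zero

variable {E : ι → H →L[ℂ] H} {hE : ∀ i, (E i).IsPositive} {hsum : ∑ i, E i = 1} {x : ι → Ω}

theorem ofFinite_op (B : Set Ω) :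
    (ofFinite E hE hsum x).op B = ∑ i, B.indicator (fun _ => E i) (x i) := rfl

theorem reInner_ofFinite (u v : H) :
    (ofFinite E hE hsum x).reInner u v =
      ∑ i, VectorMeasure.dirac (x i) (⟪u, E i v⟫_ℂ).re := by
  classical
  ext B hB
  rw [reInner_apply _ _ _ hB, ofFinite_op, FunLike.coe_sum, Finset.sum_apply,
    _root_.sum_apply, inner_sum, Complex.re_sum]
  refine Finset.sum_congr rfl fun i _ => ?_
  by_cases h : x i ∈ B
  · simp [h, hB]
  · simp [h]

theorem prob_ofFinite (ψ : H) :
    (ofFinite E hE hsum x).prob ψ =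
      ∑ i, ENNReal.ofReal (⟪ψ, E i ψ⟫_ℂ).re • Measure.dirac (x i) := by
  classical
  ext B hB
  rw [prob_apply _ _ hB, ofFinite_op, Measure.finsetSum_apply, _root_.sum_apply,
    inner_sum, Complex.re_sum, ENNReal.ofReal_sum_of_nonneg]
  · refine Finset.sum_congr rfl fun i _ => ?_
    rw [Measure.smul_apply, Measure.dirac_apply' _ hB]
    by_cases h : x i ∈ B
    · simp [h]
    · simp [h]
  · intro i _
    by_cases h : x i ∈ B
    · rw [Set.indicator_of_mem h]
      exact (hE i).re_inner_nonneg_right ψ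
    · simp [h]

variable [MeasurableSingletonClass Ω]

theorem integrable_prob_ofFinite (ψ : H) (f : Ω → ℝ) :
    Integrable f ((ofFinite E hE hsum x).prob ψ) := by
  rw [prob_ofFinite, integrable_finsetSum_measure]
  exact fun i _ => (integrable_dirac (by simp)).smul_measure ENNReal.ofReal_ne_top

theorem integral_prob_ofFinite (ψ : H) (f : Ω → ℝ) :
    ∫ ω, f ω ∂((ofFinite E hE hsum x).prob ψ) = ∑ i, f (x i) * (⟪ψ, E i ψ⟫_ℂ).re := by
  rw [prob_ofFinite, integral_finsetSum_measure fun i _ =>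
    (integrable_dirac (by simp)).smul_measure ENNReal.ofReal_ne_top]
  refine Finset.sum_congr rfl fun i _ => ?_
  rw [integral_smul_measure, integral_dirac,
    ENNReal.toReal_ofReal (show 0 ≤ (⟪ψ, E i ψ⟫_ℂ).re from (hE i).re_inner_nonneg_right ψ),
    smul_eq_mul, mul_comm]

theorem integrable_dirac_vectorMeasure (ω : Ω) (c : ℝ) (f : Ω → ℝ) :
    (VectorMeasure.dirac ω c).Integrable f := by
  change Integrable f (VectorMeasure.dirac ω c).variation
  rw [VectorMeasure.variation_dirac]
  exact (integrable_dirac (by simp)).smul_measure enorm_ne_top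

theorem integrable_reInner_ofFinite (u v : H) (f : Ω → ℝ) :
    ((ofFinite E hE hsum x).reInner u v).Integrable f := by
  rw [reInner_ofFinite]
  exact VectorMeasure.Integrable.finsetSum_vectorMeasure fun i _ =>
    integrable_dirac_vectorMeasure _ _ f

theorem vectorIntegral_reInner_ofFinite (u v : H) (f : Ω → ℝ) :
    ∫ᵛ ω, f ω ∂•((ofFinite E hE hsum x).reInner u v) = ∑ i, f (x i) * (⟪u, E i v⟫_ℂ).re := by
  rw [reInner_ofFinite, VectorMeasure.integral_finsetSum_vectorMeasure fun i _ =>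
    integrable_dirac_vectorMeasure _ _ f]
  refine Finset.sum_congr rfl fun i _ => ?_
  rw [VectorMeasure.integral_dirac]
  rfl

end Finite

end Measurement

/-- The derivative of the expectation of a symmetric operator. -/
theorem hasFDerivAt_re_inner_symmetric {m : ℕ} {φ : (Fin m → ℝ) → H} {θ : Fin m → ℝ}
    (hunit : ∀ᶠ η in 𝓝 θ, ‖φ η‖ = 1) (hφ : DifferentiableAt ℝ φ θ) {F : H →L[ℂ] H}
    (hF : ∀ u v, ⟪F u, v⟫_ℂ = ⟪u, F v⟫_ℂ) {L : (Fin m → ℝ) →L[ℝ] ℝ}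
    (hL : ∀ i, L (Pi.single i 1) = (⟪horizontalLift φ θ i, F (φ θ)⟫_ℂ).re) :
    HasFDerivAt (fun η => (⟪φ η, F (φ η)⟫_ℂ).re) L θ := by
  have h2 : HasFDerivAt (fun η => F (φ η)) _ θ :=
    (F.restrictScalars ℝ).hasFDerivAt.comp θ hφ.hasFDerivAt
  have h3 : HasFDerivAt (fun η => (⟪φ η, F (φ η)⟫_ℂ).re) _ θ :=
    Complex.reCLM.hasFDerivAt.comp θ (hφ.hasFDerivAt.inner ℂ h2)
  refine h3.congr_fderiv (ContinuousLinearMap.coe_injective ?_)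
  refine (Pi.basisFun ℝ (Fin m)).ext fun i => ?_
  rw [Pi.basisFun_apply, ContinuousLinearMap.coe_coe, ContinuousLinearMap.coe_coe, hL]
  have hre := re_inner_partialDeriv hunit hφ i
  have him : (⟪φ θ, F (φ θ)⟫_ℂ).im = 0 := by
    rw [← Complex.conj_eq_iff_im, inner_conj_symm]
    exact hF _ _
  have hsymm : (⟪φ θ, F (partialDeriv φ θ i)⟫_ℂ).re =
      (⟪partialDeriv φ θ i, F (φ θ)⟫_ℂ).re := by
    rw [← hF, ← inner_conj_symm, Complex.conj_re]
  have hre' : (⟪partialDeriv φ θ i, φ θ⟫_ℂ).re = 0 := by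
    rw [← inner_conj_symm, Complex.conj_re, hre]
  have hL' : (⟪horizontalLift φ θ i, F (φ θ)⟫_ℂ).re =
      2 * (⟪partialDeriv φ θ i, F (φ θ)⟫_ℂ).re := by
    simp [horizontalLift, inner_smul_left, inner_sub_left, him, hre']
    ring
  rw [hL', two_mul]
  nth_rewrite 1 [← hsymm]
  simp [fderivInnerCLM_apply, partialDeriv]

/-! ### An optimal estimator -/

/-- Bessel's inequality for a family of vectors that is dominated by an orthonormal one. -/
theorem sum_norm_inner_sq_le {ι : Type*} [Fintype ι] {b : ι → H}
    (hb : ∀ c : ι → ℂ, ‖∑ a, c a • b a‖ ^ 2 ≤ ∑ a, ‖c a‖ ^ 2) (v : H) :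
    ∑ a, ‖⟪b a, v⟫_ℂ‖ ^ 2 ≤ ‖v‖ ^ 2 := by
  set s := ∑ a, ‖⟪b a, v⟫_ℂ‖ ^ 2 with hs
  set w := ∑ a, ⟪b a, v⟫_ℂ • b a with hw
  have h1 : ‖w‖ ^ 2 ≤ s := hb fun a => ⟪b a, v⟫_ℂ
  have h2 : ⟪w, v⟫_ℂ = (s : ℂ) := by
    rw [hw, hs, sum_inner, Complex.ofReal_sum]
    refine Finset.sum_congr rfl fun a _ => ?_
    rw [inner_smul_left, mul_comm, Complex.mul_conj, Complex.normSq_eq_norm_sq]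
  have h3 : s ≤ ‖w‖ * ‖v‖ := by
    have := norm_inner_le_norm (𝕜 := ℂ) w v
    rw [h2, Complex.norm_real] at this
    exact (le_abs_self s).trans this
  nlinarith [sq_nonneg (‖w‖ - ‖v‖)]

/-- Bessel's inequality says that the sum of the rank-one operators is at most `1`. Domination
suffices, so no dilation of the space is needed to make the vectors orthonormal. -/
theorem isPositive_one_sub_sum_rankOne {ι : Type*} [Fintype ι] {b : ι → H}
    (hb : ∀ c : ι → ℂ, ‖∑ a, c a • b a‖ ^ 2 ≤ ∑ a, ‖c a‖ ^ 2) :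
    (1 - ∑ a, InnerProductSpace.rankOne ℂ (b a) (b a) : H →L[ℂ] H).IsPositive := by
  refine ⟨?_, fun v => ?_⟩
  · intro u v
    simp only [ContinuousLinearMap.coe_coe, _root_.sub_apply, _root_.sum_apply,
      one_apply_eq_self, InnerProductSpace.rankOne_apply, inner_sub_left,
      inner_sub_right, sum_inner, inner_sum, inner_smul_left, inner_smul_right, inner_conj_symm]
    congr 1
    exact Finset.sum_congr rfl fun a _ => mul_comm _ _
  · have h1 := sum_norm_inner_sq_le hb v
    have h2 : ∀ a, RCLike.re (⟪⟪b a, v⟫_ℂ • b a, v⟫_ℂ) = ‖⟪b a, v⟫_ℂ‖ ^ 2 := fun a => by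
      rw [inner_smul_left, mul_comm]
      exact (RCLike.mul_conj (K := ℂ) _).symm ▸ by norm_cast
    simp only [ContinuousLinearMap.reApplyInnerSelf, _root_.sub_apply, _root_.sum_apply,
      one_apply_eq_self, InnerProductSpace.rankOne_apply, inner_sub_left, sum_inner,
      map_sub, map_sum, h2]
    rw [inner_self_eq_norm_sq]
    linarith

/-- An orthonormal basis of `ℝ^ι` one of whose members has no vanishing coordinate. -/
theorem exists_orthonormal_columns {ι : Type*} [Fintype ι] [DecidableEq ι] (a₀ : ι) :
    ∃ O : ι → ι → ℝ, (∀ k, O k a₀ ≠ 0) ∧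
      ∀ a b, ∑ k, O k a * O k b = if a = b then 1 else 0 := by
  have : Nonempty ι := ⟨a₀⟩
  set c : ℝ := (√(Fintype.card ι))⁻¹ with hc
  have hcard : (0 : ℝ) < Fintype.card ι := by exact_mod_cast Fintype.card_pos
  have hc0 : c ≠ 0 := inv_ne_zero (Real.sqrt_pos.2 hcard).ne'
  -- Only the value at `a₀` is used: a normalized constant vector, to be extended to an orthonormal
  -- basis.
  let v : ι → EuclideanSpace ℝ ι := fun _ => WithLp.toLp 2 fun _ => c
  have hv : Orthonormal ℝ (Set.domRestrict {a₀} v) := by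
    refine ⟨fun _ => ?_, fun i j hij => absurd (Subsingleton.elim i j) hij⟩
    have h1 : ‖v a₀‖ ^ 2 = 1 := by
      rw [EuclideanSpace.norm_sq_eq]
      simp only [v, Real.norm_eq_abs, sq_abs, Finset.sum_const, Finset.card_univ, nsmul_eq_mul, hc]
      rw [inv_pow, Real.sq_sqrt hcard.le, mul_inv_cancel₀ hcard.ne']
    exact (pow_eq_one_iff_of_nonneg (norm_nonneg _) two_ne_zero).1 h1
  obtain ⟨b, hb⟩ := hv.exists_orthonormalBasis_extension_of_card_eq (by simp)
  refine ⟨fun k a => b a k, fun k => ?_, fun a a' => ?_⟩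
  · change b a₀ k ≠ 0
    rw [hb a₀ rfl]
    exact hc0
  · have h1 := orthonormal_iff_ite.1 b.orthonormal a a'
    rw [← h1, PiLp.inner_apply]
    refine Finset.sum_congr rfl fun k _ => ?_
    simp [mul_comm]

/-! ### From dominated vectors to an estimator. -/

section Construction

variable {m : ℕ} {φ : (Fin m → ℝ) → H} {θ : Fin m → ℝ}

/-- Vectors `p` orthogonal to `φ` and dominated by orthonormal ones, with `Re ⟨l | p⟩` invertible,
give rise to an estimator whose covariance is `Yᵀ Y`, where `Re ⟨l | p⟩ Y = 1`. -/
theorem exists_stronglyLocallyUnbiased (hunit : ∀ᶠ η in 𝓝 θ, ‖φ η‖ = 1)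
    (hφ : DifferentiableAt ℝ φ θ) {p : Fin m → H} (hpφ : ∀ j, ⟪p j, φ θ⟫_ℂ = 0)
    (hp : ∀ c : Fin m → ℂ, ‖∑ j, c j • p j‖ ^ 2 ≤ ∑ j, ‖c j‖ ^ 2)
    {Y : Matrix (Fin m) (Fin m) ℝ}
    (hY : (Matrix.of fun i j => (⟪horizontalLift φ θ i, p j⟫_ℂ).re) * Y = 1) :
    ∃ M : Measurement H (Fin m → ℝ), M.StronglyLocallyUnbiased φ θ ∧ M.cov φ θ = Yᵀ * Y := by
  have hφ1 : ‖φ θ‖ = 1 := hunit.self_of_nhds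
  -- The column at `none` gives the amplitudes `⟨β_k | φ⟩`, which must be nonzero to be divided by
  -- in the outcomes.
  obtain ⟨O, hO0, hO⟩ := exists_orthonormal_columns (none : Option (Fin m))
  let b : Option (Fin m) → H := fun a => a.elim (φ θ) p
  have hb : ∀ c : Option (Fin m) → ℂ, ‖∑ a, c a • b a‖ ^ 2 ≤ ∑ a, ‖c a‖ ^ 2 := fun c => by
    simp only [Fintype.sum_option, b, Option.elim_none, Option.elim_some]
    have h1 : ⟪c none • φ θ, ∑ j, c (some j) • p j⟫_ℂ = 0 := by
      rw [inner_sum]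
      refine Finset.sum_eq_zero fun j _ => ?_
      rw [inner_smul_left, inner_smul_right, ← inner_conj_symm, hpφ]
      simp
    have h2 := norm_add_sq_eq_norm_sq_add_norm_sq_of_inner_eq_zero _ _ h1
    rw [norm_smul, hφ1, mul_one] at h2
    have h3 := hp fun j => c (some j)
    nlinarith
  have hbφ : ∀ a, ⟪b a, φ θ⟫_ℂ = if a = none then 1 else 0 := fun a => by
    rcases a with _ | j
    · simp [b, inner_self_eq_norm_sq_to_K, hφ1]
    · simpa [b] using hpφ j
  let β : Option (Fin m) → H := fun k => ∑ a, (O k a : ℂ) • b a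
  have hβφ : ∀ k, ⟪β k, φ θ⟫_ℂ = (O k none : ℂ) := fun k => by
    simp only [β, sum_inner, inner_smul_left, hbφ, Complex.conj_ofReal, mul_ite, mul_one, mul_zero,
      Finset.sum_ite_eq', Finset.mem_univ, if_true]
  -- A real orthogonal rotation of the vectors leaves the sum of their rank-one operators unchanged.
  have hβ : ∑ k, InnerProductSpace.rankOne ℂ (β k) (β k) =
      ∑ a, InnerProductSpace.rankOne ℂ (b a) (b a) := by
    ext v
    simp only [_root_.sum_apply, InnerProductSpace.rankOne_apply, β, sum_inner, inner_smul_left,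
      Complex.conj_ofReal, Finset.smul_sum, Finset.sum_mul, Finset.sum_smul, smul_smul]
    rw [Finset.sum_comm]
    refine Finset.sum_congr rfl fun a _ => ?_
    rw [Finset.sum_comm]
    have h1 : ∀ a', ∑ k, ((O k a' : ℂ) * ⟪b a', v⟫_ℂ * (O k a : ℂ)) • b a =
        (if a' = a then ⟪b a', v⟫_ℂ else 0) • b a := fun a' => by
      have h2 : ∑ k, (O k a' : ℂ) * (O k a : ℂ) = if a' = a then 1 else 0 := by
        have := congrArg (Complex.ofReal) (hO a' a)
        push_cast at this
        rw [this]
        split_ifs <;> simp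
      rw [← Finset.sum_smul]
      congr 1
      calc ∑ k, (O k a' : ℂ) * ⟪b a', v⟫_ℂ * (O k a : ℂ) =
          (∑ k, (O k a' : ℂ) * (O k a : ℂ)) * ⟪b a', v⟫_ℂ := by
            rw [Finset.sum_mul]
            exact Finset.sum_congr rfl fun k _ => by ring
        _ = _ := by rw [h2, ite_mul, one_mul, zero_mul]
    simp [h1]
  let E : Option (Option (Fin m)) → H →L[ℂ] H := fun i =>
    i.elim (1 - ∑ k, InnerProductSpace.rankOne ℂ (β k) (β k))
      fun k => InnerProductSpace.rankOne ℂ (β k) (β k)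
  have hE : ∀ i, (E i).IsPositive := by
    rintro (_ | k)
    · change (1 - ∑ k, InnerProductSpace.rankOne ℂ (β k) (β k)).IsPositive
      rw [hβ]
      exact isPositive_one_sub_sum_rankOne hb
    · exact InnerProductSpace.isPositive_rankOne_self _
  have hsum : ∑ i, E i = 1 := by simp [E, Fintype.sum_option]
  -- The sum fixes `φ`, a unit vector orthogonal to all `p`. So the remaining operator annihilates
  -- `φ`, and its outcome, set to `θ`, affects no moment at `θ` and no first derivative.
  have hEnone : E none (φ θ) = 0 := by
    change (1 - ∑ k, InnerProductSpace.rankOne ℂ (β k) (β k)) (φ θ) = 0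
    rw [hβ]
    simp only [_root_.sub_apply, one_apply_eq_self, _root_.sum_apply,
      InnerProductSpace.rankOne_apply, hbφ, ite_smul, one_smul, zero_smul, Finset.sum_ite_eq',
      Finset.mem_univ, if_true]
    exact sub_self _
  have hEsome : ∀ k, E (some k) (φ θ) = (O k none : ℂ) • β k := fun k => by
    simp [E, hβφ]
  -- Chosen so that `t_k E_k |φ⟩` is `∑ l, O k l * Y l` times `β_k`; summed over `k`, orthogonality
  -- of `O` then returns `∑ l, Y l j • p l` for the `j`-th coordinate.
  let t : Option (Fin m) → Fin m → ℝ := fun k j => (∑ l, O k (some l) * Y l j) / O k none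
  have ht : ∀ k j, t k j * O k none = ∑ l, O k (some l) * Y l j := fun k j =>
    div_mul_cancel₀ _ (hO0 k)
  let x : Option (Option (Fin m)) → Fin m → ℝ := fun i => i.elim θ fun k => θ + t k
  have hxs : ∀ k j, x (some k) j = θ j + t k j := fun _ _ => rfl
  let M := Measurement.ofFinite E hE hsum x
  have hprob : ∀ k, (⟪φ θ, E (some k) (φ θ)⟫_ℂ).re = O k none * O k none := fun k => by
    rw [hEsome, inner_smul_right, ← inner_conj_symm, hβφ, Complex.conj_ofReal, Complex.re_ofReal_mul,
      Complex.ofReal_re]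
  have hderiv : ∀ i j, ∑ r, x r j * (⟪horizontalLift φ θ i, E r (φ θ)⟫_ℂ).re =
      if i = j then 1 else 0 := fun i j => by
    have h1 : ∀ k, (⟪horizontalLift φ θ i, E (some k) (φ θ)⟫_ℂ).re =
        O k none * ∑ l, O k (some l) * (⟪horizontalLift φ θ i, p l⟫_ℂ).re := fun k => by
      have h2 : ⟪horizontalLift φ θ i, β k⟫_ℂ = ∑ l, (O k (some l) : ℂ) *
          ⟪horizontalLift φ θ i, p l⟫_ℂ := by
        simp only [β, inner_sum, inner_smul_right, inner_add_right, Fintype.sum_option, b,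
          Option.elim_none, Option.elim_some, inner_horizontalLift hφ1, mul_zero, zero_add]
      rw [hEsome, inner_smul_right, Complex.re_ofReal_mul, h2, Complex.re_sum]
      simp only [Complex.re_ofReal_mul]
    -- Orthogonality to the column `none` removes the contribution of the constant shift `θ`.
    have h2 : ∀ l, ∑ k, O k none * O k (some l) = 0 := fun l => by rw [hO]; simp
    have h3 : ∀ l l', ∑ k, O k (some l) * O k (some l') = if l = l' then 1 else 0 :=
      fun l l' => by rw [hO]; simp
    have hY' := congrFun (congrFun hY i) j
    simp only [Matrix.mul_apply, of_apply, Matrix.one_apply] at hY'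
    rw [Fintype.sum_option, hEnone, inner_zero_right, Complex.zero_re, mul_zero, zero_add]
    calc ∑ k, x (some k) j * (⟪horizontalLift φ θ i, E (some k) (φ θ)⟫_ℂ).re
        = ∑ k, (θ j * ∑ l, (O k none * O k (some l)) * (⟪horizontalLift φ θ i, p l⟫_ℂ).re +
          ∑ l, ∑ l', (O k (some l) * O k (some l')) *
            (Y l j * (⟪horizontalLift φ θ i, p l'⟫_ℂ).re)) := by
          refine Finset.sum_congr rfl fun k _ => ?_
          rw [hxs, h1, add_mul, ← mul_assoc (t k j), ht, Finset.sum_mul_sum, Finset.mul_sum]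
          congr 1
          · simp only [mul_assoc]
          · refine Finset.sum_congr rfl fun l _ => Finset.sum_congr rfl fun l' _ => ?_
            ring
      _ = θ j * ∑ l, (∑ k, O k none * O k (some l)) * (⟪horizontalLift φ θ i, p l⟫_ℂ).re +
          ∑ l, ∑ l', (∑ k, O k (some l) * O k (some l')) *
            (Y l j * (⟪horizontalLift φ θ i, p l'⟫_ℂ).re) := by
          rw [Finset.sum_add_distrib, ← Finset.mul_sum, Finset.sum_comm]
          simp only [Finset.sum_mul]
          congr 1
          rw [Finset.sum_comm]
          exact Finset.sum_congr rfl fun l _ => Finset.sum_comm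
      _ = _ := by
          rw [← hY']
          simp [h2, h3, mul_comm]
  -- With finitely many outcomes the mean is the expectation of a bounded symmetric operator at
  -- every `η`, hence differentiable at `θ`.
  have hmean : ∀ η j, ∫ y, y j ∂(M.prob (φ η)) =
      (⟪φ η, (∑ r, (x r j : ℂ) • E r) (φ η)⟫_ℂ).re := fun η j => by
    rw [Measurement.integral_prob_ofFinite]
    simp only [_root_.sum_apply, _root_.smul_apply, inner_sum, inner_smul_right, Complex.re_sum,
      Complex.re_ofReal_mul]
  refine ⟨M, ⟨⟨fun j => ?_, fun j => ?_, fun i j => ?_, fun i j => ?_⟩, ?_, fun j => ?_⟩, ?_⟩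
  · exact (memLp_two_iff_integrable_sq (measurable_pi_apply j).aestronglyMeasurable).2
      (Measurement.integrable_prob_ofFinite _ _)
  · rw [Measurement.integral_prob_ofFinite, Fintype.sum_option, hEnone]
    have h1 : ∀ k, x (some k) j * (⟪φ θ, E (some k) (φ θ)⟫_ℂ).re =
        θ j * (O k none * O k none) + ∑ l, (O k none * O k (some l)) * Y l j := fun k => by
      rw [hprob, hxs, add_mul, ← mul_assoc (t k j), ht, Finset.sum_mul]
      congr 1
      exact Finset.sum_congr rfl fun l _ => by ring
    simp only [h1, Finset.sum_add_distrib, ← Finset.mul_sum, hO]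
    rw [Finset.sum_comm]
    simp only [← Finset.sum_mul, hO]
    simp
  · exact Measurement.integrable_reInner_ofFinite _ _ _
  · rw [Measurement.probDeriv, Measurement.vectorIntegral_reInner_ofFinite]
    exact hderiv i j
  · exact .of_forall fun η j => Measurement.integrable_prob_ofFinite _ _
  · simp only [hmean]
    refine hasFDerivAt_re_inner_symmetric hunit hφ (fun u v => ?_) fun i => ?_
    · simp only [_root_.sum_apply, _root_.smul_apply, sum_inner, inner_sum, inner_smul_left,
        inner_smul_right, Complex.conj_ofReal]
      exact Finset.sum_congr rfl fun r _ => congrArg _ ((hE r).isSymmetric u v)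
    · have h1 := hderiv i j
      simp only [_root_.sum_apply, _root_.smul_apply, inner_sum, inner_smul_right, Complex.re_sum,
        Complex.re_ofReal_mul, h1]
      simp [Pi.single_apply, eq_comm]
  · ext i j
    simp only [Measurement.cov, of_apply, Matrix.mul_apply, Matrix.transpose_apply]
    rw [Measurement.integral_prob_ofFinite, Fintype.sum_option, hEnone, inner_zero_right,
      Complex.zero_re, mul_zero, zero_add]
    have h1 : ∀ k, (x (some k) i - θ i) * (x (some k) j - θ j) *
        (⟪φ θ, E (some k) (φ θ)⟫_ℂ).re =
        ∑ l, ∑ l', (O k (some l) * O k (some l')) * (Y l i * Y l' j) := fun k => by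
      rw [hprob, hxs, hxs, add_sub_cancel_left, add_sub_cancel_left,
        show t k i * t k j * (O k none * O k none) = (t k i * O k none) * (t k j * O k none) by ring,
        ht, ht, Finset.sum_mul_sum]
      exact Finset.sum_congr rfl fun l _ => Finset.sum_congr rfl fun l' _ => by ring
    simp only [h1]
    rw [Finset.sum_comm]
    refine Finset.sum_congr rfl fun l _ => ?_
    rw [Finset.sum_comm]
    simp only [← Finset.sum_mul, hO]
    simp

end Construction

/-! ### The optimal vectors. -/

section Optimal

open scoped ComplexOrder

variable {m : ℕ} {φ : (Fin m → ℝ) → H} {θ : Fin m → ℝ}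

theorem posSemidef_cfc {n : Type*} [Fintype n] [DecidableEq n] (A : Matrix n n ℂ) {f : ℝ → ℝ}
    (hf : ∀ x, 0 ≤ f x) : (cfc f A).PosSemidef := by
  have h1 := Matrix.posSemidef_conjTranspose_mul_self (cfc (fun x => √(f x)) A)
  rw [conjTranspose_cfc, cfc_mul_cfc] at h1
  simpa only [Real.mul_self_sqrt (hf _)] using h1

/-- Coefficients of the optimal vectors with respect to the horizontal lifts. -/
def optCoeff (φ : (Fin m → ℝ) → H) (θ : Fin m → ℝ) : Matrix (Fin m) (Fin m) ℂ :=
  (invSqrt φ θ).map Complex.ofReal * cfc (fun x => (√(1 + x))⁻¹) (genMatrix φ θ)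

/-- The vectors whose real mutual Gram matrix with the lifts is the largest possible. -/
def optVector (φ : (Fin m → ℝ) → H) (θ : Fin m → ℝ) (j : Fin m) : H :=
  ∑ i, optCoeff φ θ i j • horizontalLift φ θ i

/-- This holds even when `1 + A` is singular: the reciprocal of `0` is `0`, so `(√(1 + x))⁻¹` is a
pseudo-inverse. -/
theorem one_add_genMatrix_mul_cfc (φ : (Fin m → ℝ) → H) (θ : Fin m → ℝ) :
    (1 + genMatrix φ θ) * cfc (fun x => (√(1 + x))⁻¹) (genMatrix φ θ) =
      msqrt (1 + genMatrix φ θ) := by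
  rw [msqrt_one_add_genMatrix, one_add_genMatrix_eq_cfc, cfc_mul_cfc]
  congr 1
  funext x
  rw [← div_eq_mul_inv, Real.div_sqrt]

theorem msqrt_fisher_mul_invSqrt (hreg : LinearIndependent ℝ (horizontalLift φ θ)) :
    msqrt (fisher φ θ) * invSqrt φ θ = 1 :=
  Matrix.mul_nonsing_inv _ (isUnit_det_msqrt (fisher_posDef hreg))

theorem gram_mul_optCoeff (hreg : LinearIndependent ℝ (horizontalLift φ θ)) :
    gram φ θ * optCoeff φ θ =
      (msqrt (fisher φ θ)).map Complex.ofReal * msqrt (1 + genMatrix φ θ) := by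
  rw [← one_add_genMatrix_mul_cfc, one_add_genMatrix hreg, optCoeff, ← Matrix.mul_assoc,
    ← Matrix.mul_assoc, ← Matrix.mul_assoc, ← Matrix.mul_assoc, ← map_ofReal_mul,
    msqrt_fisher_mul_invSqrt hreg, map_ofReal_one, Matrix.one_mul]

/-- This is the Gram matrix of the optimal vectors. The function on the right only takes the values
`0` and `1`, so it is a projection. -/
theorem optCoeff_gram_optCoeff (hreg : LinearIndependent ℝ (horizontalLift φ θ)) :
    (optCoeff φ θ)ᴴ * gram φ θ * optCoeff φ θ =
      cfc (fun x => (√(1 + x))⁻¹ * √(1 + x)) (genMatrix φ θ) := by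
  have h1 : ((invSqrt φ θ).map Complex.ofReal)ᴴ = (invSqrt φ θ).map Complex.ofReal := by
    nth_rewrite 2 [← transpose_invSqrt]
    ext; simp
  rw [Matrix.mul_assoc, gram_mul_optCoeff hreg, optCoeff, Matrix.conjTranspose_mul,
    conjTranspose_cfc, h1, Matrix.mul_assoc, ← Matrix.mul_assoc (Matrix.map _ _), ← map_ofReal_mul,
    invSqrt, Matrix.nonsing_inv_mul _ (isUnit_det_msqrt (fisher_posDef hreg)), map_ofReal_one,
    Matrix.one_mul, msqrt_one_add_genMatrix, cfc_mul_cfc]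

theorem norm_sum_optVector_sq_le (hreg : LinearIndependent ℝ (horizontalLift φ θ))
    (c : Fin m → ℂ) : ‖∑ j, c j • optVector φ θ j‖ ^ 2 ≤ ∑ j, ‖c j‖ ^ 2 := by
  have h1 : ∑ j, c j • optVector φ θ j = ∑ i, (optCoeff φ θ *ᵥ c) i • horizontalLift φ θ i := by
    simp only [optVector, Finset.smul_sum, smul_smul, mulVec, dotProduct, Finset.sum_smul]
    rw [Finset.sum_comm]
    simp only [mul_comm]
  have h2 := Matrix.star_dotProduct_gram_mulVec (𝕜 := ℂ) (horizontalLift φ θ)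
    (optCoeff φ θ *ᵥ c) (optCoeff φ θ *ᵥ c)
  rw [← h1, inner_self_eq_norm_sq_to_K] at h2
  change star (optCoeff φ θ *ᵥ c) ⬝ᵥ gram φ θ *ᵥ (optCoeff φ θ *ᵥ c) = _ at h2
  rw [Matrix.star_mulVec, ← Matrix.dotProduct_mulVec, Matrix.mulVec_mulVec, Matrix.mulVec_mulVec,
    optCoeff_gram_optCoeff hreg] at h2
  have h3 : (1 - cfc (fun x => (√(1 + x))⁻¹ * √(1 + x)) (genMatrix φ θ)).PosSemidef := by
    rw [← cfc_const_one ℝ (genMatrix φ θ) (genMatrix_isHermitian φ θ).isSelfAdjoint,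
      ← cfc_sub _ _ _ (continuousOn_spectrum _ _) (continuousOn_spectrum _ _)]
    exact posSemidef_cfc _ fun x => sub_nonneg.2 (inv_mul_le_one)
  have h4 := (Complex.le_def.1 (h3.dotProduct_mulVec_nonneg c)).1
  rw [Matrix.sub_mulVec, dotProduct_sub, h2, Matrix.one_mulVec, Complex.sub_re] at h4
  have h5 : (star c ⬝ᵥ c).re = ∑ j, ‖c j‖ ^ 2 := by
    simp only [dotProduct, Pi.star_apply, RCLike.star_def, Complex.re_sum, mul_comm,
      Complex.mul_conj, Complex.ofReal_re, Complex.normSq_eq_norm_sq]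
  rw [h5] at h4
  have h6 : (((‖∑ j, c j • optVector φ θ j‖ : ℝ) : ℂ) ^ 2).re =
      ‖∑ j, c j • optVector φ θ j‖ ^ 2 := by
    norm_cast
  change 0 ≤ _ - (((‖∑ j, c j • optVector φ θ j‖ : ℝ) : ℂ) ^ 2).re at h4
  rw [h6] at h4
  linarith

theorem re_inner_optVector (hreg : LinearIndependent ℝ (horizontalLift φ θ)) :
    (Matrix.of fun i j => (⟪horizontalLift φ θ i, optVector φ θ j⟫_ℂ).re) =
      msqrt (fisher φ θ) * radMatrix φ θ := by
  ext i j
  have h1 : ⟪horizontalLift φ θ i, optVector φ θ j⟫_ℂ = (gram φ θ * optCoeff φ θ) i j := by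
    simp only [optVector, inner_sum, inner_smul_right, Matrix.mul_apply]
    exact Finset.sum_congr rfl fun k _ => mul_comm _ _
  rw [of_apply, h1, gram_mul_optCoeff hreg]
  simp [Matrix.mul_apply, radMatrix]

theorem transpose_radMatrix_inv (φ : (Fin m → ℝ) → H) (θ : Fin m → ℝ) :
    ((radMatrix φ θ)⁻¹)ᵀ = (radMatrix φ θ)⁻¹ := by
  apply map_ofReal_injective
  have h1 := conjTranspose_cfc (genMatrix φ θ) fun x => (rad x)⁻¹
  rw [← radMatrix_inv_map] at h1
  refine Eq.trans ?_ h1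
  ext
  simp

/-- With `Y = R⁻¹ J^{S -1/2}` the covariance is `J^{S -1/2} R⁻² J^{S -1/2}`, and the weight `J^S`
cancels the outer factors under the trace. -/
theorem exists_optimal (hunit : ∀ᶠ η in 𝓝 θ, ‖φ η‖ = 1) (hφ : DifferentiableAt ℝ φ θ)
    (hreg : LinearIndependent ℝ (horizontalLift φ θ)) :
    ∃ M : Measurement H (Fin m → ℝ), M.StronglyLocallyUnbiased φ θ ∧
      (fisher φ θ * M.cov φ θ).trace = traceFormula φ θ := by
  obtain ⟨M, hM, hcov⟩ := exists_stronglyLocallyUnbiased hunit hφ (p := optVector φ θ)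
    (fun j => by
      simp only [optVector, sum_inner, inner_smul_left, inner_horizontalLift hunit.self_of_nhds,
        mul_zero, Finset.sum_const_zero])
    (norm_sum_optVector_sq_le hreg) (Y := (radMatrix φ θ)⁻¹ * invSqrt φ θ) (by
      rw [re_inner_optVector hreg, Matrix.mul_assoc, ← Matrix.mul_assoc (radMatrix φ θ),
        Matrix.mul_nonsing_inv _ (isUnit_det_radMatrix φ θ), Matrix.one_mul,
        msqrt_fisher_mul_invSqrt hreg])
  refine ⟨M, hM, ?_⟩
  have h1 : (fisher φ θ * M.cov φ θ).trace =
      (invSqrt φ θ * fisher φ θ * invSqrt φ θ * (radMatrix φ θ)⁻¹ ^ 2).trace := by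
    rw [hcov, Matrix.transpose_mul, transpose_radMatrix_inv, transpose_invSqrt, sq,
      ← Matrix.mul_assoc, ← Matrix.mul_assoc, ← Matrix.mul_assoc, Matrix.trace_mul_comm]
    simp only [Matrix.mul_assoc]
  rw [h1, invSqrt_mul_fisher_mul_invSqrt hreg, Matrix.one_mul]
  rfl

end Optimal

end PureStateEstimation

end

theorem mainTheorem2 {H : Type*} [NormedAddCommGroup H] [InnerProductSpace ℂ H] [CompleteSpace H]
    {m : ℕ} {Θ : Set (Fin m → ℝ)} (hΘ : IsOpen Θ) (φ : (Fin m → ℝ) → H)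
    (hunit : ∀ η ∈ Θ, ‖φ η‖ = 1) (θ : Fin m → ℝ) (hθ : θ ∈ Θ) (hφ : DifferentiableAt ℝ φ θ)
    (hreg : LinearIndependent ℝ (PureStateEstimation.horizontalLift φ θ)) :
    PureStateEstimation.IsCRBound (PureStateEstimation.fisher φ θ)
        (PureStateEstimation.covRegion φ θ) (PureStateEstimation.traceFormula φ θ) ∧
      PureStateEstimation.IsCRBound (PureStateEstimation.fisher φ θ)
        (PureStateEstimation.strongCovRegion φ θ) (PureStateEstimation.traceFormula φ θ) ∧
      PureStateEstimation.traceFormula φ θ = PureStateEstimation.eigenvalueSum φ θ := by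
  have hnear : ∀ᶠ η in nhds θ, ‖φ η‖ = 1 :=
    Filter.eventually_of_mem (hΘ.mem_nhds hθ) hunit
  obtain ⟨M, hM, htrace⟩ := PureStateEstimation.exists_optimal hnear hφ hreg
  refine ⟨⟨⟨M.cov φ θ, ⟨M, hM.toLocallyUnbiased, rfl⟩, htrace⟩, ?_⟩,
    ⟨⟨M.cov φ θ, ⟨M, hM, rfl⟩, htrace⟩, ?_⟩,
    PureStateEstimation.traceFormula_eq_eigenvalueSum hreg⟩
  · rintro _ ⟨_, ⟨M', hM', rfl⟩, rfl⟩
    exact PureStateEstimation.traceFormula_le_of_locallyUnbiased (hunit θ hθ) hreg hM'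
  · rintro _ ⟨_, ⟨M', hM', rfl⟩, rfl⟩
    exact PureStateEstimation.traceFormula_le_of_locallyUnbiased (hunit θ hθ) hreg
      hM'.toLocallyUnbiased
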